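/- Let $G$ be the universal covering group of $\mathrm{SL}_2(\mathbb R)$, and let $X_0=\tfrac12\begin{pmatrix}0&1\\-1&0\end{pmatrix}$, $X_1=\tfrac12\begin{pmatrix}0&1\\1&0\end{pmatrix}$, $X_2=\tfrac12\begin{pmatrix}1&0\\0&-1\end{pmatrix}$, a basis of $\mathfrak{sl}_2(\mathbb R)$. For a unitary representation $\pi$ of $G$ on $V$, let $H_k$ be the infinitesimal generators, $\exp(-itH_k)=\pi(\exp(tX_k))$ for $k=0,1,2$. The localisation at $\pi$ of the Dirac operator $D=\sum_k X_k\otimes c(X_k)$ on $G$ (where $X_k$ acts by right-invariant vector fields and $c(X_k)=i\sigma_k$ with $\sigma_0=\begin{pmatrix}1&0\\0&-1\end{pmatrix}$, $\sigma_1=\begin{pmatrix}0&1\\1&0\end{pmatrix}$, $\sigma_2=\begin{pmatrix}0&i\\-i&0\end{pmatrix}$) is the operator $$D_\pi=-\begin{pmatrix}H_0&H_1+iH_2\\H_1-iH_2&-H_0\end{pmatrix}\quad\text{on } V\oplus V,$$ with domain the pairs of vectors that lie in the domains of $H_0,H_1,H_2$. The Dirac cohomology localised at $\pi$ is $\ker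 D_\pi$. Let $\omega_{\ell,\pm}$ ($\ell>1/2$) be the discrete series representations of $G$ (with Casimir eigenvalue $\ell(1-\ell)$; the spectrum of $H_0$ is $\{\pm(\ell+n):n=0,1,2,\dots\}$), and let $\pi_{q,\tau}$ ($q\ge 1/4$, $0\le\tau\le1$) be the principal series representations (with Casimir eigenvalue $q$; the spectrum of $H_0$ is $\tau+\mathbb Z$). The space of $\pi_{q,\tau}$ has an orthonormal basis $(f_m)_{m\in\tau+\mathbb Z}$ with $$H_0f_m=mf_m,\qquad (H_1\pm iH_2)f_m=(q+m(m\pm1))^{1/2}f_{m\pm1}.\tag{$*$}$$ Let $\mathcal Q$ be the parabolic arc of all $(q,\tau)$ with $q+2\tau(\tau-1)=0$ and $\tau\in[1/2-1/\sqrt8,\,1/2+1/\sqrt8]$; it lies in the parameter set of the principal series. **Theorem 5.2 (Dirac cohomology).** 1. For all $\ell>1/2$ the Dirac cohomology localised at $\omega_{\ell,+}$ and at $\omega_{\ell,-}$ is zero. 2. For $q\ge1/4$ and $0\le\tau\le1$, the Dirac cohomology localised at $\pi_{q,\tau}$ is non-zero if and only if $(q,\tau)\in\mathcal Q$. 3.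 For $(q,\tau)\in\mathcal Q$ it is one-dimensional and, for every orthonormal basis $(f_m)$ as in $(*)$, it is spanned by the $2$-spinor $\begin{pmatrix}\sqrt{1-\tau}\,f_\tau\\-\sqrt\tau\,f_{\tau-1}\end{pmatrix}$, that is, by $(\sqrt{1-\tau},-\sqrt\tau)$ with respect to the basis $\begin{pmatrix}f_\tau\\0\end{pmatrix},\begin{pmatrix}0\\f_{\tau-1}\end{pmatrix}$. -/

import Mathlib

namespace DiracSL2

open MeasureTheory Set
open scoped ENNReal ComplexConjugate MatrixGroups
open Complex (I)

/-! ### Unitary representations on `L²` given by a multiplier -/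

/-- An action of `G` on the measure space `(X, μ)` together with a multiplier `m` (a cocycle) such
that `F ↦ m(g, x) F(g x)` preserves the norm of `L²(X, μ)`; the laws hold almost everywhere. -/
structure MultiplierAction (G : Type*) [Group G] {X : Type*} [MeasurableSpace X]
    (μ : Measure X) where
  act : G → X → X
  mult : G → X → ℂ
  measurable_act : ∀ g, Measurable (act g)
  measurable_mult : ∀ g, Measurable (mult g)
  mult_ne_zero : ∀ g x, mult g x ≠ 0
  act_one : ∀ᵐ x ∂μ, act 1 x = x
  mult_one : ∀ᵐ x ∂μ, mult 1 x = 1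
  act_mul : ∀ g h, ∀ᵐ x ∂μ, act (g * h) x = act g (act h x)
  mult_mul : ∀ g h, ∀ᵐ x ∂μ, mult (g * h) x = mult g (act h x) * mult h x
  lintegral_eq : ∀ g (F : X → ℝ≥0∞), Measurable F →
    ∫⁻ x, ‖mult g x‖ₑ ^ 2 * F (act g x) ∂μ = ∫⁻ x, F x ∂μ

namespace MultiplierAction

variable {G : Type*} [Group G] {X : Type*} [MeasurableSpace X] {μ : Measure X}

theorem quasi (M : MultiplierAction G μ) (g : G) :
    Measure.QuasiMeasurePreserving (M.act g) μ μ := by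
  refine ⟨M.measurable_act g, Measure.AbsolutelyContinuous.mk fun s hs h0 => ?_⟩
  rw [Measure.map_apply (M.measurable_act g) hs]
  have h := M.lintegral_eq g (s.indicator 1) (measurable_one.indicator hs)
  rw [lintegral_indicator_one hs, h0, lintegral_eq_zero_iff] at h
  · rw [measure_eq_zero_iff_ae_notMem]
    filter_upwards [h] with x hx hxs
    have hxs' : M.act g x ∈ s := hxs
    simp [hxs', M.mult_ne_zero g x] at hx
  · exact ((M.measurable_mult g).enorm.pow_const 2).mul
      ((measurable_one.indicator hs).comp (M.measurable_act g))

theorem eLpNorm_pull (M : MultiplierAction G μ) (g : G) (F : Lp ℂ 2 μ) :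
    eLpNorm (fun x => M.mult g x * F (M.act g x)) 2 μ = eLpNorm F 2 μ := by
  rw [eLpNorm_eq_lintegral_rpow_enorm_toReal (by norm_num) (by norm_num),
    eLpNorm_eq_lintegral_rpow_enorm_toReal (by norm_num) (by norm_num)]
  congr 1
  have h := M.lintegral_eq g (fun x => ‖F x‖ₑ ^ 2)
    ((Lp.stronglyMeasurable F).measurable.enorm.pow_const 2)
  simpa [enorm_mul, mul_pow] using h

theorem memLp_pull (M : MultiplierAction G μ) (g : G) (F : Lp ℂ 2 μ) :
    MemLp (fun x => M.mult g x * F (M.act g x)) 2 μ := by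
  refine ⟨(M.measurable_mult g).aestronglyMeasurable.mul
    ((Lp.aestronglyMeasurable F).comp_quasiMeasurePreserving (M.quasi g)), ?_⟩
  rw [M.eLpNorm_pull]
  exact Lp.eLpNorm_lt_top F

/-- The isometry `F ↦ m(g, x) F(g x)` of `L²(X, μ)`. -/
noncomputable def pull (M : MultiplierAction G μ) (g : G) : Lp ℂ 2 μ →ₗᵢ[ℂ] Lp ℂ 2 μ where
  toFun F := (M.memLp_pull g F).toLp _
  map_add' F₁ F₂ := by
    rw [← MemLp.toLp_add, MemLp.toLp_eq_toLp_iff]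
    filter_upwards [(M.quasi g).ae (Lp.coeFn_add F₁ F₂)] with x hx
    rw [hx, Pi.add_apply, Pi.add_apply, mul_add]
  map_smul' a F := by
    rw [RingHom.id_apply, ← MemLp.toLp_const_smul, MemLp.toLp_eq_toLp_iff]
    filter_upwards [(M.quasi g).ae (Lp.coeFn_smul a F)] with x hx
    simp [hx, mul_left_comm]
  norm_map' F := by
    change ‖(M.memLp_pull g F).toLp _‖ = ‖F‖
    rw [Lp.norm_toLp, M.eLpNorm_pull, Lp.norm_def]

theorem coeFn_pull (M : MultiplierAction G μ) (g : G) (F : Lp ℂ 2 μ) :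
    M.pull g F =ᵐ[μ] fun x => M.mult g x * F (M.act g x) :=
  MemLp.coeFn_toLp (M.memLp_pull g F)

theorem pull_one (M : MultiplierAction G μ) (F : Lp ℂ 2 μ) : M.pull 1 F = F := by
  refine Lp.ext ?_
  filter_upwards [M.coeFn_pull 1 F, M.act_one, M.mult_one] with x h1 h2 h3
  rw [h1, h2, h3, one_mul]

theorem pull_pull (M : MultiplierAction G μ) (g h : G) (F : Lp ℂ 2 μ) :
    M.pull h (M.pull g F) = M.pull (g * h) F := by
  refine Lp.ext ?_
  filter_upwards [M.coeFn_pull h (M.pull g F), (M.quasi h).ae (M.coeFn_pull g F),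
    M.coeFn_pull (g * h) F, M.act_mul g h, M.mult_mul g h] with x h1 h2 h3 h4 h5
  rw [h1, h2, h3, h4, h5]
  ring

/-- The unitary representation `(π(g) F)(x) = m(g⁻¹, x) F(g⁻¹ x)` of `G` on `L²(X, μ)`. -/
noncomputable def rep (M : MultiplierAction G μ) : G →* (Lp ℂ 2 μ ≃ₗᵢ[ℂ] Lp ℂ 2 μ) where
  toFun g :=
    { (M.pull g⁻¹) with
      invFun := M.pull g
      left_inv := fun F => by
        change M.pull g (M.pull g⁻¹ F) = F
        rw [M.pull_pull, inv_mul_cancel, M.pull_one]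
      right_inv := fun F => by
        change M.pull g⁻¹ (M.pull g F) = F
        rw [M.pull_pull, mul_inv_cancel, M.pull_one] }
  map_one' := by
    ext1 F
    change M.pull 1⁻¹ F = F
    rw [inv_one, M.pull_one]
  map_mul' g h := by
    ext1 F
    change M.pull (g * h)⁻¹ F = M.pull g⁻¹ (M.pull h⁻¹ F)
    rw [M.pull_pull, mul_inv_rev]

theorem coeFn_rep (M : MultiplierAction G μ) (g : G) (F : Lp ℂ 2 μ) :
    M.rep g F =ᵐ[μ] fun x => M.mult g⁻¹ x * F (M.act g⁻¹ x) :=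
  M.coeFn_pull g⁻¹ F

end MultiplierAction

/-- The restriction of a unitary representation to an invariant subspace. -/
noncomputable def subRep {G : Type*} [Group G] {V : Type*} [NormedAddCommGroup V]
    [InnerProductSpace ℂ V] (π : G →* (V ≃ₗᵢ[ℂ] V)) (W : Submodule ℂ V)
    (hW : ∀ g, ∀ v ∈ W, π g v ∈ W) : G →* (W ≃ₗᵢ[ℂ] W) where
  toFun g :=
    { toFun := fun w => ⟨π g w, hW g w w.2⟩
      map_add' := fun v w => by ext1; simp
      map_smul' := fun a w => by ext1; simp
      invFun := fun w => ⟨π g⁻¹ w, hW g⁻¹ w w.2⟩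
      left_inv := fun w => by ext1; simp [map_inv]
      right_inv := fun w => by ext1; simp [map_inv]
      norm_map' := fun w => by
        change ‖π g w‖ = ‖(w : V)‖
        simp }
  map_one' := by ext1 w; ext1; simp
  map_mul' g h := by ext1 w; ext1; simp

/-! ### `SL₂(ℝ)` acting on the closed unit disc, and its universal covering group -/

namespace SL2

/-- The Cayley transform conjugates `g = (a b; c d)` to the matrix `(α β; β̄ ᾱ)` of `SU(1,1)`, with
`α = ((a + d) + i (b - c)) / 2` and `β = ((a - d) - i (b + c)) / 2`. -/
noncomputable def α (g : SL(2, ℝ)) : ℂ := ⟨(g 0 0 + g 1 1) / 2, (g 0 1 - g 1 0) / 2⟩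
/-- The upper right entry of the `SU(1,1)`-matrix attached to `g`. -/
noncomputable def β (g : SL(2, ℝ)) : ℂ := ⟨(g 0 0 - g 1 1) / 2, -(g 0 1 + g 1 0) / 2⟩

/-- The automorphy factor `β̄ z + ᾱ`, without zeros on the closed unit disc. -/
noncomputable def j (g : SL(2, ℝ)) (z : ℂ) : ℂ := conj (β g) * z + conj (α g)
/-- The Möbius action `z ↦ (α z + β) / (β̄ z + ᾱ)` on the closed unit disc. -/
noncomputable def mob (g : SL(2, ℝ)) (z : ℂ) : ℂ := (α g * z + β g) / j g z

theorem α_one : α 1 = 1 := by simp [α, Complex.ext_iff]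
theorem β_one : β 1 = 0 := by simp [β, Complex.ext_iff]
theorem α_mul (g h : SL(2, ℝ)) : α (g * h) = α g * α h + β g * conj (β h) := by
  simp [α, β, Complex.ext_iff, Matrix.mul_apply, Fin.sum_univ_two]
  constructor <;> ring
theorem β_mul (g h : SL(2, ℝ)) : β (g * h) = α g * β h + β g * conj (α h) := by
  simp [α, β, Complex.ext_iff, Matrix.mul_apply, Fin.sum_univ_two]
  constructor <;> ring
theorem normSq_sub (g : SL(2, ℝ)) : ‖α g‖ ^ 2 - ‖β g‖ ^ 2 = 1 := by
  have h := g.det_coe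
  rw [Matrix.det_fin_two] at h
  rw [← Complex.normSq_eq_norm_sq, ← Complex.normSq_eq_norm_sq, Complex.normSq_apply,
    Complex.normSq_apply, α, β]
  linear_combination h
theorem conj_sub (g : SL(2, ℝ)) : α g * conj (α g) - β g * conj (β g) = 1 := by
  rw [Complex.mul_conj, Complex.mul_conj, Complex.normSq_eq_norm_sq, Complex.normSq_eq_norm_sq]
  exact_mod_cast normSq_sub g
theorem norm_β_lt (g : SL(2, ℝ)) : ‖β g‖ < ‖α g‖ := by
  nlinarith [normSq_sub g, norm_nonneg (α g), norm_nonneg (β g)]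
theorem α_ne_zero (g : SL(2, ℝ)) : α g ≠ 0 :=
  norm_pos_iff.mp ((norm_nonneg _).trans_lt (norm_β_lt g))

theorem norm_ratio_lt (g : SL(2, ℝ)) {z : ℂ} (hz : ‖z‖ ≤ 1) :
    ‖conj (β g) / conj (α g) * z‖ < 1 := by
  rw [norm_mul, norm_div, RCLike.norm_conj, RCLike.norm_conj]
  have h1 : ‖β g‖ / ‖α g‖ < 1 :=
    (div_lt_one ((norm_nonneg _).trans_lt (norm_β_lt g))).2 (norm_β_lt g)
  have h2 : 0 ≤ ‖β g‖ / ‖α g‖ := by positivity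
  nlinarith [norm_nonneg z]

theorem re_pos (g : SL(2, ℝ)) {z : ℂ} (hz : ‖z‖ ≤ 1) :
    0 < (1 + conj (β g) / conj (α g) * z).re := by
  have h := (Complex.abs_re_le_norm (conj (β g) / conj (α g) * z)).trans_lt (norm_ratio_lt g hz)
  rw [Complex.add_re, Complex.one_re]
  linarith [(abs_lt.mp h).1]

theorem j_eq (g : SL(2, ℝ)) (z : ℂ) :
    j g z = conj (α g) * (1 + conj (β g) / conj (α g) * z) := by
  have h : conj (α g) ≠ 0 := by simpa using α_ne_zero g
  rw [j]; field_simp; ring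

theorem j_ne_zero (g : SL(2, ℝ)) {z : ℂ} (hz : ‖z‖ ≤ 1) : j g z ≠ 0 := by
  rw [j_eq]
  refine mul_ne_zero (by simpa using α_ne_zero g) fun h => ?_
  have := re_pos g hz
  rw [h] at this
  simp at this

theorem one_sub_norm_mob (g : SL(2, ℝ)) {z : ℂ} (hz : ‖z‖ ≤ 1) :
    1 - ‖mob g z‖ ^ 2 = (1 - ‖z‖ ^ 2) / ‖j g z‖ ^ 2 := by
  have hj := norm_ne_zero_iff.mpr (j_ne_zero g hz)
  rw [mob, norm_div, div_pow, eq_div_iff (by positivity), sub_mul, one_mul,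
    div_mul_cancel₀ _ (by positivity)]
  have e : ((‖j g z‖ ^ 2 - ‖α g * z + β g‖ ^ 2 : ℝ) : ℂ) = ((1 - ‖z‖ ^ 2 : ℝ) : ℂ) := by
    push_cast
    rw [← Complex.mul_conj', ← Complex.mul_conj', ← Complex.mul_conj', j]
    simp only [map_add, map_mul, Complex.conj_conj]
    linear_combination (1 - z * conj z) * conj_sub g
  exact_mod_cast e

theorem norm_mob_le (g : SL(2, ℝ)) {z : ℂ} (hz : ‖z‖ ≤ 1) : ‖mob g z‖ ≤ 1 := by
  have h := one_sub_norm_mob g hz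
  have : 0 ≤ (1 - ‖z‖ ^ 2) / ‖j g z‖ ^ 2 :=
    div_nonneg (by nlinarith [norm_nonneg z]) (by positivity)
  nlinarith [norm_nonneg (mob g z)]

theorem norm_mob_lt (g : SL(2, ℝ)) {z : ℂ} (hz : ‖z‖ < 1) : ‖mob g z‖ < 1 := by
  have h := one_sub_norm_mob g hz.le
  have : 0 < (1 - ‖z‖ ^ 2) / ‖j g z‖ ^ 2 :=
    div_pos (by nlinarith [norm_nonneg z])
      (pow_pos (norm_pos_iff.mpr (j_ne_zero g hz.le)) 2)
  nlinarith [norm_nonneg (mob g z)]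

theorem j_mul (g h : SL(2, ℝ)) {z : ℂ} (hz : ‖z‖ ≤ 1) :
    j (g * h) z = j g (mob h z) * j h z := by
  have hj := j_ne_zero h hz
  rw [j, j, mob, add_mul, mul_div_assoc', div_mul_cancel₀ _ hj, j, α_mul, β_mul]
  simp only [map_add, map_mul, Complex.conj_conj]
  ring

theorem mob_mul (g h : SL(2, ℝ)) {z : ℂ} (hz : ‖z‖ ≤ 1) :
    mob (g * h) z = mob g (mob h z) := by
  have hj := j_ne_zero h hz
  have h1 := j_ne_zero g (norm_mob_le h hz)
  rw [mob, j_mul g h hz, mob.eq_def g, div_eq_div_iff (mul_ne_zero h1 hj) h1]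
  have : mob h z * j h z = α h * z + β h := div_mul_cancel₀ _ hj
  have e : (α (g * h) * z + β (g * h)) = (α g * mob h z + β g) * j h z := by
    rw [add_mul, mul_assoc, this, α_mul, β_mul, j]; ring
  rw [e]; ring

theorem mob_one (z : ℂ) : mob 1 z = z := by simp [mob, j, α_one, β_one]

end SL2

open SL2

/-- The universal covering group of `SL₂(ℝ)`: an element is a matrix `g` in `SL₂(ℝ)` together with
a logarithm `c` of `ᾱ(g) = j(g, 0)`. So it is the pull-back of the universal covering
`exp : ℂ → ℂ \ {0}` along the homotopy equivalence `g ↦ ᾱ(g)` from `SL₂(ℝ)` to `ℂ \ {0}`. -/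
@[ext]
structure SL2Cover where
  mat : SL(2, ℝ)
  c : ℂ
  exp_c : Complex.exp c = conj (α mat)

namespace SL2Cover

/-- The continuous logarithm on the closed unit disc of the automorphy factor `z ↦ j(g, z)`, with value
`c` at `z = 0`. -/
noncomputable def logj (g : SL2Cover) (z : ℂ) : ℂ :=
  g.c + Complex.log (1 + conj (β g.mat) / conj (α g.mat) * z)

theorem exp_logj (g : SL2Cover) {z : ℂ} (hz : ‖z‖ ≤ 1) :
    Complex.exp (g.logj z) = j g.mat z := by
  have h : 1 + conj (β g.mat) / conj (α g.mat) * z ≠ 0 := fun h => by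
    have := re_pos g.mat hz
    rw [h] at this
    simp at this
  rw [logj, Complex.exp_add, g.exp_c, Complex.exp_log h, ← j_eq]

theorem logj_zero (g : SL2Cover) : g.logj 0 = g.c := by simp [logj]

/-- The product: `logj (g h) z = logj g (h z) + logj h z`, the value at `z = 0` being `c`. -/
noncomputable instance : Mul SL2Cover where
  mul g h :=
    { mat := g.mat * h.mat
      c := g.logj (mob h.mat 0) + h.logj 0
      exp_c := by
        rw [Complex.exp_add, g.exp_logj (norm_mob_le _ (by simp)), h.exp_logj (by simp),
          ← j_mul _ _ (by simp)]
        simp [j] }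

noncomputable instance : One SL2Cover where
  one := { mat := 1, c := 0, exp_c := by simp [α_one] }

noncomputable instance : Inv SL2Cover where
  inv g :=
    { mat := g.mat⁻¹
      c := -g.logj (mob g.mat⁻¹ 0)
      exp_c := by
        have h := j_mul g.mat g.mat⁻¹ (z := 0) (by simp)
        rw [mul_inv_cancel] at h
        have h1 : j 1 0 = 1 := by simp [j, α_one]
        have h2 : j g.mat⁻¹ 0 = conj (α g.mat⁻¹) := by simp [j]
        rw [Complex.exp_neg, g.exp_logj (norm_mob_le _ (by simp)), ← h2]
        rw [h1] at h
        exact inv_eq_of_mul_eq_one_right h.symm }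

theorem mat_mul (g h : SL2Cover) : (g * h).mat = g.mat * h.mat := rfl
theorem mat_one : (1 : SL2Cover).mat = 1 := rfl
theorem mat_inv (g : SL2Cover) : (g⁻¹).mat = g.mat⁻¹ := rfl
theorem c_mul (g h : SL2Cover) : (g * h).c = g.logj (mob h.mat 0) + h.c := by
  change g.logj (mob h.mat 0) + h.logj 0 = _
  rw [logj_zero]

theorem logj_one (z : ℂ) : (1 : SL2Cover).logj z = 0 := by
  change (0 : ℂ) + Complex.log (1 + conj (β 1) / conj (α 1) * z) = 0
  simp [α_one, β_one]

theorem logj_mul (g h : SL2Cover) {z : ℂ} (hz : ‖z‖ ≤ 1) :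
    (g * h).logj z = g.logj (mob h.mat z) + h.logj z := by
  have h0 : ‖(0 : ℂ)‖ ≤ 1 := by simp
  have e : Complex.exp (g.logj (mob h.mat z) + h.logj z - (g * h).logj z) = 1 := by
    rw [Complex.exp_sub, Complex.exp_add, exp_logj _ (norm_mob_le _ hz), exp_logj _ hz,
      exp_logj _ hz, mat_mul, j_mul _ _ hz, div_self]
    exact mul_ne_zero (j_ne_zero _ (norm_mob_le _ hz)) (j_ne_zero _ hz)
  obtain ⟨n, hn⟩ := Complex.exp_eq_one_iff.mp e
  have hn0 : n = 0 := by
    have him := congrArg Complex.im hn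
    have a1 := Complex.abs_arg_lt_pi_div_two_iff.mpr (.inl (re_pos g.mat (norm_mob_le h.mat hz)))
    have a2 := Complex.abs_arg_lt_pi_div_two_iff.mpr (.inl (re_pos h.mat hz))
    have a3 := Complex.abs_arg_lt_pi_div_two_iff.mpr (.inl (re_pos g.mat (norm_mob_le h.mat h0)))
    have a4 := Complex.abs_arg_lt_pi_div_two_iff.mpr (.inl (re_pos (g * h).mat hz))
    rw [abs_lt] at a1 a2 a3 a4
    rw [logj, logj, logj, c_mul, logj] at him
    simp only [Complex.sub_im, Complex.add_im, Complex.log_im, Complex.mul_im, Complex.intCast_re,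
      Complex.intCast_im, zero_mul, add_zero, Complex.I_im, Complex.re_ofNat, Complex.ofReal_re,
      Complex.im_ofNat, Complex.ofReal_im, Complex.mul_re, Complex.I_re, mul_zero, mul_one,
      sub_zero] at him
    have hlt : (n : ℝ) * (2 * Real.pi) < 1 * (2 * Real.pi) := by linarith
    have hgt : (-1) * (2 * Real.pi) < (n : ℝ) * (2 * Real.pi) := by linarith
    have l1 := lt_of_mul_lt_mul_right hlt Real.two_pi_pos.le
    have l2 := lt_of_mul_lt_mul_right hgt Real.two_pi_pos.le
    have l1' : n < 1 := by exact_mod_cast l1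
    have l2' : -1 < n := by exact_mod_cast l2
    omega
  rw [hn0] at hn
  simp at hn
  linear_combination -hn

noncomputable instance : Group SL2Cover :=
  Group.ofRightAxioms
    (fun a b c => by
      refine SL2Cover.ext (by simp only [mat_mul, mul_assoc]) ?_
      rw [c_mul, c_mul, c_mul, logj_mul _ _ (norm_mob_le _ (by simp)), mat_mul,
        mob_mul _ _ (by simp)]
      ring)
    (fun a => by
      refine SL2Cover.ext (by simp only [mat_mul, mat_one, mul_one]) ?_
      rw [c_mul, mat_one, mob_one, logj_zero]
      exact add_zero _)
    (fun a => by
      refine SL2Cover.ext (by simp only [mat_mul, mat_inv, mul_inv_cancel, mat_one]) ?_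
      rw [c_mul]
      exact add_neg_cancel _)

end SL2Cover

namespace SL2Cover

theorem hasDerivAt_logj (g : SL2Cover) {z : ℂ} (hz : ‖z‖ ≤ 1) :
    HasDerivAt g.logj (conj (β g.mat) / j g.mat z) z := by
  have h1 : HasDerivAt (fun z : ℂ => 1 + conj (β g.mat) / conj (α g.mat) * z)
      (conj (β g.mat) / conj (α g.mat)) z := by
    simpa using ((hasDerivAt_id z).const_mul (conj (β g.mat) / conj (α g.mat))).const_add 1
  have h2 := (h1.clog (.inl (re_pos g.mat hz))).const_add g.c
  refine HasDerivAt.congr_deriv h2 ?_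
  rw [j_eq, div_div]

theorem measurable_logj (g : SL2Cover) : Measurable g.logj := by
  unfold logj
  exact measurable_const.add
    (Complex.measurable_log.comp (measurable_const.add (measurable_const.mul measurable_id)))

theorem norm_exp_re (g : SL2Cover) {z : ℂ} (hz : ‖z‖ ≤ 1) :
    Real.exp (g.logj z).re = ‖j g.mat z‖ := by
  rw [← g.exp_logj hz, Complex.norm_exp]

theorem hasDerivAt_mob (g : SL(2, ℝ)) {z : ℂ} (hz : ‖z‖ ≤ 1) :
    HasDerivAt (mob g) (1 / j g z ^ 2) z := by
  have h1 : HasDerivAt (fun z : ℂ => α g * z + β g) (α g) z := by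
    simpa using ((hasDerivAt_id z).const_mul (α g)).add_const (β g)
  have h2 : HasDerivAt (j g) (conj (β g)) z :=
    (((hasDerivAt_id z).const_mul (conj (β g))).add_const (conj (α g))).congr_deriv (mul_one _)
  refine HasDerivAt.congr_deriv (h1.div h2 (j_ne_zero g hz)) ?_
  congr 1
  rw [j]
  linear_combination conj_sub g

theorem measurable_mob (g : SL(2, ℝ)) : Measurable (mob g) := by
  unfold mob j
  fun_prop

/-! ### The principal series -/

instance fact_two_pi_pos : Fact (0 < 2 * Real.pi) := ⟨Real.two_pi_pos⟩

/-- The point `e^{ix}` of the unit circle, as a complex number. -/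
noncomputable def circlePt (x : AddCircle (2 * Real.pi)) : ℂ := (AddCircle.toCircle x : ℂ)

theorem norm_circlePt (x : AddCircle (2 * Real.pi)) : ‖circlePt x‖ = 1 := Circle.norm_coe _

theorem circlePt_coe (x : ℝ) : circlePt (x : AddCircle (2 * Real.pi)) = Complex.exp (x * I) := by
  rw [circlePt, AddCircle.toCircle_apply_mk, Circle.coe_exp, div_self Real.two_pi_pos.ne', one_mul]

theorem measurable_circlePt : Measurable circlePt :=
  (continuous_subtype_val.comp AddCircle.continuous_toCircle).measurable

/-- The action of the covering group on the circle `ℝ / 2πℤ`: `x ↦ x - 2 Im (log j(g, e^{ix}))`; in the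
coordinate `z = e^{ix}` it is the Möbius action (`circlePt_circleAct`). -/
noncomputable def circleAct (g : SL2Cover) (x : AddCircle (2 * Real.pi)) :
    AddCircle (2 * Real.pi) :=
  x - ((2 * (g.logj (circlePt x)).im : ℝ) : AddCircle (2 * Real.pi))

theorem circlePt_circleAct (g : SL2Cover) (x : AddCircle (2 * Real.pi)) :
    circlePt (g.circleAct x) = mob g.mat (circlePt x) := by
  have hz := norm_circlePt x
  have hj := j_ne_zero g.mat hz.le
  have hzz : circlePt x * conj (circlePt x) = 1 := by
    rw [Complex.mul_conj', hz]; simp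
  have hjc : conj (j g.mat (circlePt x)) ≠ 0 := by simpa using hj
  have hl := g.exp_logj hz.le
  have e1 : circlePt (g.circleAct x)
      = circlePt x * Complex.exp (((-(2 * (g.logj (circlePt x)).im) : ℝ) : ℂ) * I) := by
    rw [← circlePt_coe, circleAct, sub_eq_add_neg, ← AddCircle.coe_neg, circlePt, AddCircle.toCircle_add,
      Circle.coe_mul]
    rfl
  have e2 : (((-(2 * (g.logj (circlePt x)).im) : ℝ) : ℂ) * I)
      = conj (g.logj (circlePt x)) - g.logj (circlePt x) := by
    apply Complex.ext <;> simp; ring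
  rw [e1, e2, Complex.exp_sub, Complex.exp_conj, hl, mob, ← mul_div_assoc]
  congr 1
  rw [j]
  simp only [map_add, map_mul, Complex.conj_conj]
  linear_combination (β g.mat) * hzz

/-- The lift of the action from the circle to the real line. -/
noncomputable def lift (g : SL2Cover) (x : ℝ) : ℝ := x - 2 * (g.logj (Complex.exp (x * I))).im

theorem coe_lift (g : SL2Cover) (x : ℝ) :
    ((g.lift x : ℝ) : AddCircle (2 * Real.pi)) = g.circleAct x := by
  rw [lift, circleAct, circlePt_coe, AddCircle.coe_sub]

theorem lift_add (g : SL2Cover) (x : ℝ) : g.lift (x + 2 * Real.pi) = g.lift x + 2 * Real.pi := by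
  have : Complex.exp (((x + 2 * Real.pi : ℝ) : ℂ) * I) = Complex.exp (x * I) := by
    rw [← circlePt_coe, ← circlePt_coe, AddCircle.coe_add_period]
  rw [lift, lift, this]; ring

theorem hasDerivAt_lift (g : SL2Cover) (x : ℝ) :
    HasDerivAt g.lift (1 / ‖j g.mat (Complex.exp (x * I))‖ ^ 2) x := by
  have hz : ‖Complex.exp (x * I)‖ = 1 := Complex.norm_exp_ofReal_mul_I x
  set z := Complex.exp (x * I) with hzdef
  have hj := j_ne_zero g.mat hz.le
  have h1 : HasDerivAt (fun x : ℝ => Complex.exp (x * I)) (z * I) x := by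
    have := ((hasDerivAt_id x).ofReal_comp.mul_const I).cexp
    simpa using this
  have h2 : HasDerivAt (fun x : ℝ => g.logj (Complex.exp (x * I)))
      (conj (β g.mat) / j g.mat z * (z * I)) x :=
    HasDerivAt.comp (h₂ := g.logj) x (g.hasDerivAt_logj hz.le) h1
  have h3 : HasDerivAt (fun x : ℝ => (g.logj (Complex.exp (x * I))).im)
      (conj (β g.mat) / j g.mat z * (z * I)).im x :=
    Complex.imCLM.hasFDerivAt.comp_hasDerivAt x h2
  have h4 := (hasDerivAt_id x).sub (h3.const_mul 2)
  refine HasDerivAt.congr_deriv h4 ?_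
  have hzz : z * conj z = 1 := by rw [Complex.mul_conj', hz]; simp
  have hjn : (‖j g.mat z‖ : ℂ) ^ 2 ≠ 0 := by simpa using hj
  have hjc : conj (j g.mat z) ≠ 0 := by simpa using hj
  apply Complex.ofReal_injective
  push_cast
  rw [Complex.im_eq_sub_conj, ← Complex.mul_conj', eq_div_iff (mul_ne_zero hj hjc)]
  simp only [map_mul, map_div₀, Complex.conj_conj, Complex.conj_I]
  have hI := Complex.I_sq
  field_simp
  rw [j]
  simp only [map_add, map_mul, Complex.conj_conj]
  linear_combination -(β g.mat * conj (β g.mat)) * hzz + conj_sub g.mat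

theorem lintegral_circle (g : SL2Cover) (F : AddCircle (2 * Real.pi) → ENNReal) :
    ∫⁻ x, ENNReal.ofReal (1 / ‖j g.mat (circlePt x)‖ ^ 2) * F (g.circleAct x) = ∫⁻ x, F x := by
  have hpos : ∀ x : ℝ, 0 < 1 / ‖j g.mat (Complex.exp (x * I))‖ ^ 2 := fun x =>
    one_div_pos.mpr (pow_pos (norm_pos_iff.mpr
      (j_ne_zero g.mat (Complex.norm_exp_ofReal_mul_I x).le)) 2)
  have hmono : StrictMono g.lift := strictMono_of_deriv_pos fun x => by
    rw [(g.hasDerivAt_lift x).deriv]; exact hpos x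
  have hcont : Continuous g.lift :=
    continuous_iff_continuousAt.mpr fun x => (g.hasDerivAt_lift x).continuousAt
  have himg : g.lift '' Ioc 0 (0 + 2 * Real.pi)
      = Ioc (g.lift 0) (g.lift 0 + 2 * Real.pi) := by
    rw [← lift_add]
    refine Subset.antisymm ?_ (intermediate_value_Ioc (by linarith [Real.pi_pos])
      hcont.continuousOn)
    rintro _ ⟨x, hx, rfl⟩
    exact ⟨hmono hx.1, hmono.monotone hx.2⟩
  rw [← AddCircle.lintegral_preimage (2 * Real.pi) 0,
    ← AddCircle.lintegral_preimage (2 * Real.pi) (g.lift 0), ← himg,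
    lintegral_image_eq_lintegral_abs_deriv_mul measurableSet_Ioc
      (fun x _ => (g.hasDerivAt_lift x).hasDerivWithinAt) hmono.injective.injOn]
  refine lintegral_congr fun x => ?_
  rw [coe_lift, circlePt_coe, abs_of_pos (hpos x)]

/-- The multiplier `|j|^{-(1 + 2iσ)} e^{-2iτ arg j}`, where `log |j|` and `arg j` are the real and the
imaginary part of the chosen logarithm of `j(g, e^{ix})`. -/
noncomputable def principalMult (σ τ : ℝ) (g : SL2Cover) (x : AddCircle (2 * Real.pi)) : ℂ :=
  Complex.exp (-(1 + 2 * σ * I) * (g.logj (circlePt x)).re - 2 * τ * I * (g.logj (circlePt x)).im)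

theorem enorm_principalMult_sq (σ τ : ℝ) (g : SL2Cover) (x : AddCircle (2 * Real.pi)) :
    ‖principalMult σ τ g x‖ₑ ^ 2 = ENNReal.ofReal (1 / ‖j g.mat (circlePt x)‖ ^ 2) := by
  rw [← ofReal_norm, ← ENNReal.ofReal_pow (norm_nonneg _), ← norm_exp_re g (norm_circlePt x).le,
    principalMult, Complex.norm_exp, one_div, ← Real.exp_nat_mul, ← Real.exp_nat_mul,
    ← Real.exp_neg]
  congr 2
  simp

/-- The circle with its invariant probability measure and the principal series multiplier. -/
noncomputable def principalAction (σ τ : ℝ) :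
    MultiplierAction SL2Cover (AddCircle.haarAddCircle (T := 2 * Real.pi)) where
  act := circleAct
  mult := principalMult σ τ
  measurable_act g := by
    have h : Measurable fun x : AddCircle (2 * Real.pi) =>
        ((2 * (g.logj (circlePt x)).im : ℝ) : AddCircle (2 * Real.pi)) :=
      AddCircle.measurable_mk'.comp ((Complex.measurable_im.comp
        (g.measurable_logj.comp measurable_circlePt)).const_mul 2)
    exact measurable_id.sub h
  measurable_mult g := by
    have h := g.measurable_logj.comp measurable_circlePt
    have h1 := Complex.measurable_ofReal.comp (Complex.measurable_re.comp h)
    have h2 := Complex.measurable_ofReal.comp (Complex.measurable_im.comp h)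
    exact Complex.measurable_exp.comp ((h1.const_mul _).sub (h2.const_mul _))
  mult_ne_zero g x := Complex.exp_ne_zero _
  act_one := .of_forall fun x => by simp [circleAct, logj_one]
  mult_one := .of_forall fun x => by simp [principalMult, logj_one]
  act_mul g h := .of_forall fun x => by
    rw [circleAct.eq_def g, circlePt_circleAct, circleAct, circleAct, logj_mul _ _ (norm_circlePt x).le,
      Complex.add_im, mul_add, AddCircle.coe_add]
    abel
  mult_mul g h := .of_forall fun x => by
    rw [principalMult, principalMult, principalMult, circlePt_circleAct, logj_mul _ _ (norm_circlePt x).le,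
      ← Complex.exp_add, Complex.add_im, Complex.add_re]
    push_cast
    congr 1; ring
  lintegral_eq g F hF := by
    have h := g.lintegral_circle F
    rw [AddCircle.volume_eq_smul_haarAddCircle, lintegral_smul_measure, lintegral_smul_measure,
      smul_eq_mul, smul_eq_mul] at h
    simp only [enorm_principalMult_sq]
    exact (ENNReal.mul_right_inj (by simpa using Real.two_pi_pos) ENNReal.ofReal_ne_top).mp h

/-! ### The discrete series -/

/-- The identity for the sign `true` and complex conjugation for the sign `false`. -/
noncomputable def conjIf (s : Bool) (z : ℂ) : ℂ := if s then z else conj z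

theorem conjIf_add (s : Bool) (z w : ℂ) : conjIf s (z + w) = conjIf s z + conjIf s w := by
  cases s <;> simp [conjIf]

theorem conjIf_mul (s : Bool) (z w : ℂ) : conjIf s (z * w) = conjIf s z * conjIf s w := by
  cases s <;> simp [conjIf]

theorem conjIf_exp (s : Bool) (z : ℂ) : conjIf s (Complex.exp z) = Complex.exp (conjIf s z) := by
  cases s <;> simp [conjIf, Complex.exp_conj]

theorem conjIf_ofReal (s : Bool) (x : ℝ) : conjIf s x = x := by
  cases s <;> simp [conjIf]

theorem conjIf_re (s : Bool) (z : ℂ) : (conjIf s z).re = z.re := by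
  cases s <;> simp [conjIf]

theorem measurable_conjIf (s : Bool) : Measurable (conjIf s) := by
  cases s
  · exact Complex.continuous_conj.measurable
  · exact measurable_id

/-- The measure `(1 - |z|²)^{2ℓ - 2} dx dy` on the open unit disc. -/
noncomputable def discMeasure (l : ℝ) : Measure ℂ :=
  (volume.restrict (Metric.ball 0 1)).withDensity
    fun z => ENNReal.ofReal ((1 - ‖z‖ ^ 2) ^ (2 * l - 2))

theorem ae_discMeasure (l : ℝ) {p : ℂ → Prop} (h : ∀ z, ‖z‖ < 1 → p z) :
    ∀ᵐ z ∂discMeasure l, p z := by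
  have h1 : ∀ᵐ z ∂(volume.restrict (Metric.ball (0 : ℂ) 1)), p z := by
    filter_upwards [ae_restrict_mem measurableSet_ball] with z hz
    exact h z (by simpa using hz)
  exact (withDensity_absolutelyContinuous _ _).ae_le h1

/-- The multiplier `j(g, z)^{-2ℓ}` (sign `true`) or its complex conjugate (sign `false`), the power being
taken with the chosen logarithm. -/
noncomputable def discMult (l : ℝ) (s : Bool) (g : SL2Cover) (z : ℂ) : ℂ :=
  Complex.exp (-(2 * l : ℝ) * conjIf s (g.logj z))

theorem enorm_discMult_sq (l : ℝ) (s : Bool) (g : SL2Cover) {z : ℂ} (hz : ‖z‖ ≤ 1) :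
    ‖discMult l s g z‖ₑ ^ 2 = ENNReal.ofReal (‖j g.mat z‖ ^ (-(4 * l))) := by
  rw [← ofReal_norm, ← ENNReal.ofReal_pow (norm_nonneg _), ← norm_exp_re g hz,
    discMult, Complex.norm_exp, ← Real.exp_nat_mul, ← Real.exp_mul]
  congr 2
  rw [← Complex.ofReal_neg, Complex.re_ofReal_mul, conjIf_re]
  push_cast
  ring

theorem abs_det_mob (g : SL(2, ℝ)) {z : ℂ} :
    |(((ContinuousLinearMap.toSpanSingleton ℂ (1 / j g z ^ 2)).restrictScalars ℝ :
      ℂ →L[ℝ] ℂ)).det| = (‖j g z‖ ^ 4)⁻¹ := by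
  have : ((((ContinuousLinearMap.toSpanSingleton ℂ (1 / j g z ^ 2)).restrictScalars ℝ :
      ℂ →L[ℝ] ℂ)) : ℂ →ₗ[ℝ] ℂ) = LinearMap.mulLeft ℝ (1 / j g z ^ 2) := by
    ext w; simp [mul_comm]
  rw [ContinuousLinearMap.det, this]
  have h2 := Algebra.norm_complex_apply (1 / j g z ^ 2)
  rw [Algebra.norm_apply] at h2
  change |LinearMap.det ((Algebra.lmul ℝ ℂ) (1 / j g z ^ 2))| = _
  rw [h2, Complex.normSq_eq_norm_sq]
  simp [abs_of_nonneg]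
  ring

theorem mob_image_ball (g : SL(2, ℝ)) : mob g '' Metric.ball 0 1 = Metric.ball 0 1 := by
  refine Subset.antisymm ?_ ?_
  · rintro _ ⟨z, hz, rfl⟩
    simpa using norm_mob_lt g (by simpa using hz)
  · intro z hz
    have hz' : ‖z‖ < 1 := by simpa using hz
    exact ⟨mob g⁻¹ z, by simpa using norm_mob_lt g⁻¹ hz',
      by rw [← mob_mul _ _ hz'.le, mul_inv_cancel, mob_one]⟩

theorem mob_injOn (g : SL(2, ℝ)) : InjOn (mob g) (Metric.ball 0 1) := by
  intro z hz w hw h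
  have hz' : ‖z‖ ≤ 1 := by simpa using (Metric.mem_ball.mp hz).le
  have hw' : ‖w‖ ≤ 1 := by simpa using (Metric.mem_ball.mp hw).le
  have := congrArg (mob g⁻¹) h
  rwa [← mob_mul _ _ hz', ← mob_mul _ _ hw', inv_mul_cancel, mob_one, mob_one] at this

theorem lintegral_disc (l : ℝ) (s : Bool) (g : SL2Cover) (F : ℂ → ENNReal) (hF : Measurable F) :
    ∫⁻ z, ‖discMult l s g z‖ₑ ^ 2 * F (mob g.mat z) ∂discMeasure l
      = ∫⁻ z, F z ∂discMeasure l := by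
  have hw : Measurable fun z : ℂ => ENNReal.ofReal ((1 - ‖z‖ ^ 2) ^ (2 * l - 2)) := by fun_prop
  have hm : Measurable fun z => ‖discMult l s g z‖ₑ ^ 2 * F (mob g.mat z) :=
    ((Complex.measurable_exp.comp (((measurable_conjIf s).comp g.measurable_logj).const_mul
      _)).enorm.pow_const 2).mul (hF.comp (measurable_mob _))
  rw [discMeasure, lintegral_withDensity_eq_lintegral_mul _ hw hm,
    lintegral_withDensity_eq_lintegral_mul _ hw hF]
  conv_rhs => rw [← mob_image_ball g.mat]
  rw [lintegral_image_eq_lintegral_abs_det_fderiv_mul volume measurableSet_ball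
    (f' := fun z => (ContinuousLinearMap.toSpanSingleton ℂ (1 / j g.mat z ^ 2)).restrictScalars ℝ)
    (fun z hz => ((hasDerivAt_mob g.mat (by simpa using (Metric.mem_ball.mp hz).le)
      ).hasFDerivAt.restrictScalars ℝ).hasFDerivWithinAt) (mob_injOn _)]
  refine setLIntegral_congr_fun measurableSet_ball fun z hz => ?_
  have hz' : ‖z‖ < 1 := by simpa using hz
  have hj : 0 < ‖j g.mat z‖ := norm_pos_iff.mpr (j_ne_zero _ hz'.le)
  have h1 : 0 < 1 - ‖z‖ ^ 2 := by nlinarith [norm_nonneg z]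
  simp only [Pi.mul_apply]
  rw [abs_det_mob, enorm_discMult_sq l s g hz'.le, one_sub_norm_mob _ hz'.le, ← mul_assoc,
    ← mul_assoc, ← ENNReal.ofReal_mul (by positivity), ← ENNReal.ofReal_mul (by positivity),
    Real.div_rpow h1.le (by positivity), ← Real.rpow_natCast ‖j g.mat z‖ 2, ← Real.rpow_mul hj.le,
    ← Real.rpow_natCast ‖j g.mat z‖ 4, ← Real.rpow_neg hj.le, div_eq_mul_inv,
    ← Real.rpow_neg hj.le, mul_left_comm, ← Real.rpow_add hj]
  congr 4
  push_cast
  ring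

/-- The weighted unit disc with the discrete series multiplier. -/
noncomputable def discAction (l : ℝ) (s : Bool) : MultiplierAction SL2Cover (discMeasure l) where
  act g := mob g.mat
  mult := discMult l s
  measurable_act g := measurable_mob g.mat
  measurable_mult g := Complex.measurable_exp.comp
    (((measurable_conjIf s).comp g.measurable_logj).const_mul _)
  mult_ne_zero g x := Complex.exp_ne_zero _
  act_one := .of_forall fun z => mob_one z
  mult_one := .of_forall fun z => by simp [discMult, logj_one, conjIf]
  act_mul g h := ae_discMeasure l fun z hz => mob_mul _ _ hz.le
  mult_mul g h := ae_discMeasure l fun z hz => by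
    rw [discMult, discMult, discMult, logj_mul _ _ hz.le, conjIf_add, mul_add, Complex.exp_add]
  lintegral_eq g F hF := lintegral_disc l s g F hF

/-- The weighted Bergman space: the square integrable functions on the disc that are holomorphic
(sign `true`) or antiholomorphic (sign `false`). -/
noncomputable def discreteSpace (l : ℝ) (s : Bool) : Submodule ℂ (Lp ℂ 2 (discMeasure l)) where
  carrier := {F | ∃ f : ℂ → ℂ, DifferentiableOn ℂ f (Metric.ball 0 1) ∧
    F =ᵐ[discMeasure l] fun z => conjIf s (f z)}
  add_mem' := by
    rintro F₁ F₂ ⟨f₁, h₁, e₁⟩ ⟨f₂, h₂, e₂⟩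
    refine ⟨f₁ + f₂, h₁.add h₂, ?_⟩
    filter_upwards [Lp.coeFn_add F₁ F₂, e₁, e₂] with z hz a b
    rw [hz, Pi.add_apply, a, b, Pi.add_apply, conjIf_add]
  zero_mem' := by
    refine ⟨0, differentiableOn_const _, ?_⟩
    filter_upwards [Lp.coeFn_zero ℂ 2 (discMeasure l)] with z hz
    rw [hz]; cases s <;> simp [conjIf]
  smul_mem' := by
    rintro a F ⟨f, h, e⟩
    refine ⟨fun z => conjIf s a * f z, h.const_mul _, ?_⟩
    filter_upwards [Lp.coeFn_smul a F, e] with z hz b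
    rw [hz, Pi.smul_apply, b, conjIf_mul, smul_eq_mul]
    cases s <;> simp [conjIf]

theorem rep_mem_discreteSpace (l : ℝ) (s : Bool) (g : SL2Cover) (F : Lp ℂ 2 (discMeasure l))
    (hF : F ∈ discreteSpace l s) : (discAction l s).rep g F ∈ discreteSpace l s := by
  obtain ⟨f, hf, e⟩ := hF
  refine ⟨fun z => Complex.exp (-(2 * l : ℝ) * g⁻¹.logj z) * f (mob g⁻¹.mat z), ?_, ?_⟩
  · refine DifferentiableOn.mul (DifferentiableOn.cexp (DifferentiableOn.const_mul ?_ _))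
      (hf.comp ?_ ?_)
    · exact fun z hz => (hasDerivAt_logj _ (by simpa using
        (Metric.mem_ball.mp hz).le)).differentiableAt.differentiableWithinAt
    · exact fun z hz => (hasDerivAt_mob _ (by simpa using
        (Metric.mem_ball.mp hz).le)).differentiableAt.differentiableWithinAt
    · exact fun z hz => by simpa using norm_mob_lt _ (by simpa using hz)
  · filter_upwards [(discAction l s).coeFn_rep g F, ((discAction l s).quasi g⁻¹).ae e]
      with z h1 h2
    rw [h1, h2, conjIf_mul, conjIf_exp, conjIf_mul, ← Complex.ofReal_neg, conjIf_ofReal]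
    simp [discAction, discMult]

end SL2Cover

open SL2Cover

/-! ### The representations, and the localised Dirac operator -/

/-- The principal series representation `π_{q,τ}` on `L²(ℝ/2πℤ)`, where `q = 1/4 + σ²`:
`(π(g) F)(x) = |j|^{-(1 + 2iσ)} e^{-2iτ arg j} F(g⁻¹ x)` with `j = j(g⁻¹, e^{ix})`. -/
noncomputable def principalSeries (q τ : ℝ) :
    SL2Cover →* (Lp ℂ 2 (AddCircle.haarAddCircle (T := 2 * Real.pi)) ≃ₗᵢ[ℂ]
      Lp ℂ 2 (AddCircle.haarAddCircle (T := 2 * Real.pi))) :=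
  (principalAction (√(q - 1 / 4)) τ).rep

/-- The discrete series representation `ω_{ℓ,+}` (sign `true`) or `ω_{ℓ,-}` (sign `false`):
`(ω(g) F)(z) = j(g⁻¹, z)^{-2ℓ} F(g⁻¹ z)` on holomorphic functions for `ω_{ℓ,+}`, and the complex
conjugate representation, on antiholomorphic functions, for `ω_{ℓ,-}`. -/
noncomputable def discreteSeries (l : ℝ) (s : Bool) :
    SL2Cover →* (discreteSpace l s ≃ₗᵢ[ℂ] discreteSpace l s) :=
  subRep (discAction l s).rep (discreteSpace l s) (rep_mem_discreteSpace l s)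

/-- The one-parameter subgroups `t ↦ exp(t X_k)` of the covering group, for the basis
`X₀ = ½ (0 1; -1 0)`, `X₁ = ½ (0 1; 1 0)`, `X₂ = ½ (1 0; 0 -1)` of `sl₂(ℝ)`, which has the brackets
`[X₀, X₁] = X₂`, `[X₀, X₂] = -X₁`, `[X₁, X₂] = -X₀`. The component `c` is the continuous logarithm of
`ᾱ(exp(t X_k))` that vanishes at `t = 0`. -/
noncomputable def oneParam : Fin 3 → ℝ → SL2Cover
  | 0, t =>
    { mat := ⟨!![Real.cos (t / 2), Real.sin (t / 2); -Real.sin (t / 2), Real.cos (t / 2)], by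
        rw [Matrix.det_fin_two_of]; linear_combination Real.cos_sq_add_sin_sq (t / 2)⟩
      c := -((t / 2 : ℝ) * I)
      exp_c := by
        rw [← neg_mul, ← Complex.ofReal_neg, Complex.exp_mul_I]
        apply Complex.ext <;> simp [α, Complex.cos_ofReal_re, Complex.sin_ofReal_re,
          Complex.cos_ofReal_im, Complex.sin_ofReal_im, -Complex.ofReal_div] }
  | 1, t =>
    { mat := ⟨!![Real.cosh (t / 2), Real.sinh (t / 2); Real.sinh (t / 2), Real.cosh (t / 2)], by
        rw [Matrix.det_fin_two_of]; linear_combination Real.cosh_sq (t / 2)⟩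
      c := (Real.log (Real.cosh (t / 2)) : ℝ)
      exp_c := by
        rw [← Complex.ofReal_exp, Real.exp_log (Real.cosh_pos _)]
        apply Complex.ext <;> simp [α, -Complex.ofReal_cosh] }
  | 2, t =>
    { mat := ⟨!![Real.exp (t / 2), 0; 0, Real.exp (-(t / 2))], by
        rw [Matrix.det_fin_two_of, ← Real.exp_add]; simp⟩
      c := (Real.log (Real.cosh (t / 2)) : ℝ)
      exp_c := by
        rw [← Complex.ofReal_exp, Real.exp_log (Real.cosh_pos _)]
        apply Complex.ext <;> simp [α, Real.cosh_eq, -Complex.ofReal_exp, -Complex.ofReal_cosh] }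

section Dirac

variable {V : Type*} [NormedAddCommGroup V] [InnerProductSpace ℂ V]

/-- The self-adjoint infinitesimal generator `H_k`, with `exp(-itH_k) = π(exp(t X_k))`: the operator
`H_k v = i (d/dt) π(exp(t X_k)) v` at `t = 0`, on all `v` for which this derivative exists. -/
noncomputable def generator (π : SL2Cover →* (V ≃ₗᵢ[ℂ] V)) (k : Fin 3) : V →ₗ.[ℂ] V where
  domain :=
    { carrier := {v | DifferentiableAt ℝ (fun t : ℝ => π (oneParam k t) v) 0}
      add_mem' := fun {v w} hv hw => by
        have h := DifferentiableAt.fun_add (Set.mem_ofPred.mp hv) (Set.mem_ofPred.mp hw)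
        simpa only [Set.mem_ofPred_eq, map_add] using h
      zero_mem' := by simp
      smul_mem' := fun a v hv => by
        have h := DifferentiableAt.fun_const_smul (Set.mem_ofPred.mp hv) a
        simpa only [Set.mem_ofPred_eq, map_smul] using h }
  toFun :=
    { toFun := fun v => I • deriv (fun t : ℝ => π (oneParam k t) (v : V)) 0
      map_add' := fun v w => by
        rw [← smul_add, ← deriv_fun_add v.2 w.2]
        simp only [Submodule.coe_add, map_add]
      map_smul' := fun a v => by
        rw [RingHom.id_apply, smul_comm, ← deriv_fun_const_smul a v.2]
        simp only [Submodule.coe_smul, map_smul] }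

/-- Clifford multiplication `c(X_k) = i σ_k` by the basis vectors on the space `ℂ²` of spinors. -/
noncomputable def clifford : Fin 3 → Matrix (Fin 2) (Fin 2) ℂ
  | 0 => I • !![1, 0; 0, -1]
  | 1 => I • !![0, 1; 1, 0]
  | 2 => I • !![0, I; -I, 0]

/-- The localisation at `π` of the Dirac operator `D = ∑ X_k ⊗ c(X_k)`, on `V ⊗ ℂ² = V ⊕ V`. In `D` the
`X_k` act on functions on the group as right-invariant vector fields,
`(X_k f)(g) = (d/dt) f(exp(t X_k) g)`, and the Fourier transform `f ↦ ∫ f(g) π(g) dg` turns `X_k` into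
`i H_k`. So this is the operator `-(H₀, H₁ + i H₂; H₁ - i H₂, -H₀)`, on its natural domain. -/
noncomputable def localDirac (π : SL2Cover →* (V ≃ₗᵢ[ℂ] V)) :
    (Fin 2 → V) →ₗ.[ℂ] (Fin 2 → V) where
  domain :=
    { carrier := {ψ | ∀ a k, ψ a ∈ (generator π k).domain}
      add_mem' := fun h₁ h₂ a k => add_mem (h₁ a k) (h₂ a k)
      zero_mem' := fun _ _ => zero_mem _
      smul_mem' := fun c _ h a k => Submodule.smul_mem _ c (h a k) }
  toFun :=
    { toFun := fun ψ a => ∑ k, ∑ b,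
        clifford k a b • (I • generator π k ⟨ψ.1 b, ψ.2 b k⟩)
      map_add' := fun ψ χ => by
        ext a
        simp only [Pi.add_apply, ← Finset.sum_add_distrib, ← smul_add, ← LinearPMap.map_add]
        rfl
      map_smul' := fun c ψ => by
        ext a
        simp only [Pi.smul_apply, RingHom.id_apply, Finset.smul_sum]
        refine Finset.sum_congr rfl fun k _ => Finset.sum_congr rfl fun b _ => ?_
        rw [smul_comm c, smul_comm c I, ← LinearPMap.map_smul (generator π k) c]
        rfl }

/-- The Dirac cohomology localised at `π`: the kernel of the localised Dirac operator. -/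
noncomputable def diracCohomology (π : SL2Cover →* (V ≃ₗᵢ[ℂ] V)) : Submodule ℂ (Fin 2 → V) :=
  (LinearMap.ker (localDirac π).toFun).map (localDirac π).domain.subtype

/-- `f` is an orthonormal basis of eigenvectors of `H₀` on which the ladder operators act in the
normalised way; `f n` is the vector `f_m` for `m = τ + n`:
`H₀ f_m = m f_m`, `(H₁ ± i H₂) f_m = (q + m (m ± 1))^{1/2} f_{m ± 1}`. -/
structure IsWeightBasis (π : SL2Cover →* (V ≃ₗᵢ[ℂ] V)) (q τ : ℝ) (f : HilbertBasis ℤ ℂ V) :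
    Prop where
  mem : ∀ n k, f n ∈ (generator π k).domain
  weight : ∀ n : ℤ, generator π 0 ⟨f n, mem n 0⟩ = ((τ + n : ℝ) : ℂ) • f n
  raise : ∀ n : ℤ, generator π 1 ⟨f n, mem n 1⟩ + I • generator π 2 ⟨f n, mem n 2⟩
    = ((√(q + (τ + n) * (τ + n + 1)) : ℝ) : ℂ) • f (n + 1)
  lower : ∀ n : ℤ, generator π 1 ⟨f n, mem n 1⟩ - I • generator π 2 ⟨f n, mem n 2⟩
    = ((√(q + (τ + n) * (τ + n - 1)) : ℝ) : ℂ) • f (n - 1)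

end Dirac

/-- The arc `q + 2τ(τ - 1) = 0`, `τ ∈ [1/2 - 1/√8, 1/2 + 1/√8]`, in the `(q, τ)`-plane. -/
def parabolicArc : Set (ℝ × ℝ) :=
  {p | p.1 + 2 * p.2 * (p.2 - 1) = 0 ∧ p.2 ∈ Icc (1 / 2 - 1 / √8) (1 / 2 + 1 / √8)}

end DiracSL2

namespace DiracSL2

open MeasureTheory Set
open scoped ENNReal ComplexConjugate MatrixGroups
open Complex (I)
open SL2 SL2Cover

/-! In the principal series the Dirac equation splits into 2×2 systems. Pair a kernel spinor with a
weight basis and move the symmetric generators onto the basis vectors (`inner_generator`). The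
coefficient a of the first component at weight m + 1 and the coefficient b of the second at weight m
then satisfy (m + 1) a + r b = 0 and r a - m b = 0, where r² = q + m(m + 1); no other coefficient
enters. Up to sign the determinant is q + 2m(m + 1). For q ≥ 1/4 it can vanish only if -1 < m < 0,
which for 0 ≤ τ ≤ 1 means m = τ - 1, and then it is the equation of the arc. On the arc this one
system has rank one, and its solution line is spanned by the given spinor
(`IsWeightBasis.diracCohomology_eq_span`).

This needs a weight basis of the concrete representation. The functions z^n on the circle are
differentiable vectors, and differentiating their orbits gives ladder coefficients of the right
modulus but with phases; rescaling each z^n by a unit complex number removes the phases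
(`exists_isWeightBasis`).

For the discrete series no weight basis is constructed. The generators act on holomorphic functions
as first-order differential operators (`generator_discreteSeries_ae`), with H₀ = ℓ + z∂, H₁ + iH₂ =
-(2ℓz + z²∂) and H₁ - iH₂ = -∂. A solution whose second component starts with c z^n must satisfy P c
= 0 for a positive number P depending on ℓ and n, so it vanishes (`eq_zero_of_dirac_ode`). Complex
conjugation reduces the antiholomorphic case to the holomorphic one. -/

/-! ### The one-parameter subgroups and their automorphy factors. -/

theorem α_oneParam_zero (t : ℝ) : α (oneParam 0 t).mat = Complex.exp ((t / 2 : ℝ) * I) := by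
  rw [Complex.exp_mul_I]
  apply Complex.ext <;> simp [oneParam, α, Complex.cos_ofReal_re, Complex.sin_ofReal_re,
    Complex.cos_ofReal_im, Complex.sin_ofReal_im, -Complex.ofReal_div]

theorem β_oneParam_zero (t : ℝ) : β (oneParam 0 t).mat = 0 := by
  apply Complex.ext <;> simp [oneParam, β]

theorem α_oneParam_one (t : ℝ) : α (oneParam 1 t).mat = (Real.cosh (t / 2) : ℝ) := by
  apply Complex.ext <;> simp [oneParam, α, -Complex.ofReal_cosh]

theorem β_oneParam_one (t : ℝ) : β (oneParam 1 t).mat = -((Real.sinh (t / 2) : ℝ) * I) := by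
  apply Complex.ext <;> simp [oneParam, β, -Complex.ofReal_sinh]

theorem α_oneParam_two (t : ℝ) : α (oneParam 2 t).mat = (Real.cosh (t / 2) : ℝ) := by
  apply Complex.ext <;>
    simp [oneParam, α, Real.cosh_eq, -Complex.ofReal_exp, -Complex.ofReal_cosh]

theorem β_oneParam_two (t : ℝ) : β (oneParam 2 t).mat = (Real.sinh (t / 2) : ℝ) := by
  apply Complex.ext <;>
    simp [oneParam, β, Real.sinh_eq, -Complex.ofReal_exp, -Complex.ofReal_sinh]

/-- The direction of the derivative of the automorphy factor along `exp(t X_k)`, `k = 1, 2`. -/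
noncomputable def hypDir : Fin 3 → ℂ
  | 0 => 0
  | 1 => I
  | 2 => 1

theorem j_oneParam_zero (t : ℝ) (z : ℂ) :
    j (oneParam 0 t).mat z = Complex.exp (-((t / 2 : ℝ) * I)) := by
  rw [j, α_oneParam_zero, β_oneParam_zero, ← Complex.exp_conj]
  simp [-Complex.ofReal_div]

theorem j_oneParam {k : Fin 3} (hk : k ≠ 0) (t : ℝ) (z : ℂ) :
    j (oneParam k t).mat z
      = (Real.cosh (t / 2) : ℝ) + hypDir k * z * (Real.sinh (t / 2) : ℝ) := by
  fin_cases k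
  · simp at hk
  · change j (oneParam 1 t).mat z = _
    rw [j, α_oneParam_one, β_oneParam_one]
    simp only [map_neg, map_mul, Complex.conj_ofReal, Complex.conj_I]
    simp only [hypDir]; ring
  · change j (oneParam 2 t).mat z = _
    rw [j, α_oneParam_two, β_oneParam_two]
    simp only [Complex.conj_ofReal]
    simp only [hypDir]; ring

theorem α_oneParam {k : Fin 3} (hk : k ≠ 0) (t : ℝ) :
    α (oneParam k t).mat = (Real.cosh (t / 2) : ℝ) := by
  fin_cases k
  · simp at hk
  · exact α_oneParam_one t
  · exact α_oneParam_two t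

theorem c_oneParam {k : Fin 3} (hk : k ≠ 0) (t : ℝ) :
    (oneParam k t).c = (Real.log (Real.cosh (t / 2)) : ℝ) := by
  fin_cases k
  · simp at hk
  · rfl
  · rfl

theorem logj_oneParam_zero (t : ℝ) (z : ℂ) :
    (oneParam 0 t).logj z = -((t / 2 : ℝ) * I) := by
  rw [logj, β_oneParam_zero]
  simp [oneParam]

theorem j_oneParam_re_pos {k : Fin 3} (hk : k ≠ 0) (t : ℝ) {z : ℂ} (hz : ‖z‖ ≤ 1) :
    0 < (j (oneParam k t).mat z).re := by
  rw [j_eq, α_oneParam hk, Complex.conj_ofReal, Complex.re_ofReal_mul]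
  have h := re_pos (oneParam k t).mat hz
  rw [α_oneParam hk, Complex.conj_ofReal] at h
  exact mul_pos (Real.cosh_pos _) h

/-- Along the two hyperbolic subgroups the automorphy factor stays in the right half plane, so the
branch stored in the covering group is the principal one and can be differentiated as `Complex.log`.
For the rotations the factor winds around 0, and the stored branch -it/2 is used instead. -/
theorem logj_oneParam {k : Fin 3} (hk : k ≠ 0) (t : ℝ) {z : ℂ} (hz : ‖z‖ ≤ 1) :
    (oneParam k t).logj z = Complex.log (j (oneParam k t).mat z) := by
  have h : 1 + conj (β (oneParam k t).mat) / conj (α (oneParam k t).mat) * z ≠ 0 := fun h => by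
    have := re_pos (oneParam k t).mat hz
    rw [h] at this
    simp at this
  rw [logj, j_eq, c_oneParam hk]
  rw [α_oneParam hk, Complex.conj_ofReal] at h ⊢
  rw [Complex.log_ofReal_mul (Real.cosh_pos _) h]

theorem oneParam_mul_neg (k : Fin 3) (t : ℝ) : oneParam k t * oneParam k (-t) = 1 := by
  have hmat : (oneParam k t * oneParam k (-t)).mat = 1 := by
    rw [mat_mul]
    apply Subtype.ext
    rw [Matrix.SpecialLinearGroup.coe_mul, Matrix.SpecialLinearGroup.coe_one]
    have e1 := Real.cos_sq_add_sin_sq (t / 2)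
    have e2 := Real.cosh_sq (t / 2)
    have e3 : Real.exp (t / 2) * Real.exp (-(t / 2)) = 1 := by rw [← Real.exp_add]; simp
    fin_cases k <;> ext i j <;> fin_cases i <;> fin_cases j <;>
      simp [oneParam, Matrix.mul_apply, Fin.sum_univ_two, neg_div] <;> linarith
  refine SL2Cover.ext hmat ?_
  change _ = (0 : ℂ)
  have h0 : ‖(0 : ℂ)‖ ≤ 1 := by simp
  rw [c_mul, ← logj_zero (oneParam k (-t))]
  by_cases hk : k = 0
  · subst hk
    rw [logj_oneParam_zero, logj_oneParam_zero]
    push_cast; ring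
  -- The cocycle identity at 0 makes the two automorphy factors 1/cosh and cosh, so their real
  -- logarithms cancel.
  · have h1 := j_mul (oneParam k t).mat (oneParam k (-t)).mat h0
    rw [← mat_mul, hmat] at h1
    have h2 : j 1 0 = 1 := by simp [j, α_one]
    have h3 : j (oneParam k (-t)).mat 0 = (Real.cosh (t / 2) : ℝ) := by
      rw [j_oneParam hk]; simp [neg_div, -Complex.ofReal_cosh]
    have hc : ((Real.cosh (t / 2) : ℝ) : ℂ) ≠ 0 :=
      Complex.ofReal_ne_zero.mpr (Real.cosh_pos _).ne'
    rw [h2, h3] at h1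
    rw [logj_oneParam hk _ (norm_mob_le _ h0), logj_oneParam hk _ h0, h3,
      eq_div_of_mul_eq hc h1.symm, one_div, ← Complex.ofReal_inv, ← Complex.ofReal_log
      (inv_nonneg.mpr (Real.cosh_pos _).le), ← Complex.ofReal_log (Real.cosh_pos _).le,
      Real.log_inv]
    simp

theorem oneParam_inv (k : Fin 3) (t : ℝ) : (oneParam k t)⁻¹ = oneParam k (-t) :=
  inv_eq_of_mul_eq_one_right (oneParam_mul_neg k t)

theorem oneParam_at_zero (k : Fin 3) : oneParam k 0 = 1 := by
  have hc : (oneParam k 0).c = 0 := by fin_cases k <;> simp [oneParam]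
  refine SL2Cover.ext ?_ hc
  apply Subtype.ext
  rw [mat_one, Matrix.SpecialLinearGroup.coe_one]
  fin_cases k <;> ext i j <;> fin_cases i <;> fin_cases j <;> simp [oneParam]

/-! ### The Dirac kernel in terms of a weight basis. -/

section Abstract

variable {V : Type*} [NormedAddCommGroup V] [InnerProductSpace ℂ V]
  {π : SL2Cover →* (V ≃ₗᵢ[ℂ] V)}

theorem generator_apply {k : Fin 3} (v : (generator π k).domain) :
    generator π k v = I • deriv (fun t : ℝ => π (oneParam k t) (v : V)) 0 := rfl

theorem mem_generator_domain {k : Fin 3} {v : V} :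
    v ∈ (generator π k).domain ↔ DifferentiableAt ℝ (fun t : ℝ => π (oneParam k t) v) 0 :=
  Iff.rfl

theorem hasDerivAt_oneParam {k : Fin 3} (v : (generator π k).domain) :
    HasDerivAt (fun t : ℝ => π (oneParam k t) (v : V)) (-I • generator π k v) 0 := by
  rw [generator_apply, smul_smul, neg_mul, Complex.I_mul_I, neg_neg, one_smul]
  exact (mem_generator_domain.mp v.2).hasDerivAt

theorem generator_eq_of_hasDerivAt {k : Fin 3} {v w : V}
    (h : HasDerivAt (fun t : ℝ => π (oneParam k t) v) w 0) (hv : v ∈ (generator π k).domain) :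
    generator π k ⟨v, hv⟩ = I • w := by
  rw [generator_apply, h.deriv]

/-- Unitarity moves exp(tX) across the inner product as exp(-tX); differentiate at t = 0. Symmetry
suffices throughout, self-adjointness is never used. -/
theorem inner_generator {k : Fin 3} (v w : (generator π k).domain) :
    inner ℂ (generator π k v) (w : V) = inner ℂ (v : V) (generator π k w) := by
  have e : ∀ t : ℝ, inner ℂ (π (oneParam k t) (v : V)) (w : V)
      = inner ℂ (v : V) (π (oneParam k (-t)) (w : V)) := fun t => by
    have h : π (oneParam k t) (π (oneParam k (-t)) (w : V)) = w := by
      change (π (oneParam k t) * π (oneParam k (-t))) (w : V) = w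
      rw [← map_mul, oneParam_mul_neg, map_one]
      rfl
    rw [← (π (oneParam k t)).inner_map_map (v : V), h]
  have h1 := (hasDerivAt_oneParam v).inner ℂ (hasDerivAt_const (0 : ℝ) (w : V))
  have h2 := (hasDerivAt_const (0 : ℝ) (v : V)).inner ℂ
    (HasDerivAt.scomp (0 : ℝ) (by simpa using hasDerivAt_oneParam w) (hasDerivAt_neg (0 : ℝ)))
  have h3 := h1.unique (h2.congr_of_eventuallyEq (.of_forall fun t => e t))
  simp only [inner_zero_right, inner_zero_left, zero_add, add_zero, neg_smul, one_smul, neg_neg,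
    inner_neg_left, inner_smul_left, inner_smul_right, Complex.conj_I] at h3
  simpa using h3

/-- The factor i of the Clifford matrices and the factor i of X_k ↦ iH_k multiply to a global sign,
which the kernel does not see. -/
theorem mem_diracCohomology {ψ : Fin 2 → V} :
    ψ ∈ diracCohomology π ↔ ∃ h : ∀ a k, ψ a ∈ (generator π k).domain,
      generator π 0 ⟨ψ 0, h 0 0⟩
        + (generator π 1 ⟨ψ 1, h 1 1⟩ + I • generator π 2 ⟨ψ 1, h 1 2⟩) = 0 ∧
      generator π 1 ⟨ψ 0, h 0 1⟩ - I • generator π 2 ⟨ψ 0, h 0 2⟩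
        - generator π 0 ⟨ψ 1, h 1 0⟩ = 0 := by
  have key : ∀ h : ∀ a k, ψ a ∈ (generator π k).domain,
      (localDirac π).toFun ⟨ψ, h⟩ = 0 ↔
      generator π 0 ⟨ψ 0, h 0 0⟩
        + (generator π 1 ⟨ψ 1, h 1 1⟩ + I • generator π 2 ⟨ψ 1, h 1 2⟩) = 0 ∧
      generator π 1 ⟨ψ 0, h 0 1⟩ - I • generator π 2 ⟨ψ 0, h 0 2⟩
        - generator π 0 ⟨ψ 1, h 1 0⟩ = 0 := by
    intro h
    have e : ∀ a, (localDirac π).toFun ⟨ψ, h⟩ a = ∑ k, ∑ b,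
        clifford k a b • (I • generator π k ⟨ψ b, h b k⟩) := fun a => rfl
    have e0 : (localDirac π).toFun ⟨ψ, h⟩ 0 = -(generator π 0 ⟨ψ 0, h 0 0⟩
        + (generator π 1 ⟨ψ 1, h 1 1⟩ + I • generator π 2 ⟨ψ 1, h 1 2⟩)) := by
      rw [e]
      simp [Fin.sum_univ_three, Fin.sum_univ_two, clifford, smul_smul]
      module
    have e1 : (localDirac π).toFun ⟨ψ, h⟩ 1 = -(generator π 1 ⟨ψ 0, h 0 1⟩
        - I • generator π 2 ⟨ψ 0, h 0 2⟩ - generator π 0 ⟨ψ 1, h 1 0⟩) := by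
      rw [e]
      simp [Fin.sum_univ_three, Fin.sum_univ_two, clifford, smul_smul]
      module
    rw [funext_iff, Fin.forall_fin_two, e0, e1, Pi.zero_apply, Pi.zero_apply, neg_eq_zero,
      neg_eq_zero]
  rw [diracCohomology, Submodule.mem_map]
  constructor
  · rintro ⟨⟨χ, h⟩, hk, rfl⟩
    exact ⟨h, (key h).mp hk⟩
  · rintro ⟨h, hk⟩
    exact ⟨⟨ψ, h⟩, (key h).mpr hk, rfl⟩

/-- The generators are unbounded and cannot be applied termwise to the expansion of ψ. Pairing with
f n and shifting them onto f n avoids this; the shift exchanges raising and lowering. -/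
theorem IsWeightBasis.repr_eq {q τ : ℝ} {f : HilbertBasis ℤ ℂ V} (hf : IsWeightBasis π q τ f)
    {ψ : Fin 2 → V} (hψ : ψ ∈ diracCohomology π) (n : ℤ) :
    ((τ + n : ℝ) : ℂ) * f.repr (ψ 0) n
        + ((√(q + (τ + n) * (τ + n - 1)) : ℝ) : ℂ) * f.repr (ψ 1) (n - 1) = 0 ∧
      ((√(q + (τ + n) * (τ + n + 1)) : ℝ) : ℂ) * f.repr (ψ 0) (n + 1)
        - ((τ + n : ℝ) : ℂ) * f.repr (ψ 1) n = 0 := by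
  obtain ⟨h, h0, h1⟩ := mem_diracCohomology.mp hψ
  have s := fun a k => inner_generator ⟨f n, hf.mem n k⟩ ⟨ψ a, h a k⟩
  simp only at s
  have w := hf.weight n
  have r := congrArg (fun v => inner ℂ v (ψ 0)) (hf.raise n)
  have l := congrArg (fun v => inner ℂ v (ψ 1)) (hf.lower n)
  have h0' := congrArg (fun v => inner ℂ (f n) v) h0
  have h1' := congrArg (fun v => inner ℂ (f n) v) h1
  simp only [inner_add_left, inner_sub_left, inner_add_right, inner_sub_right, inner_smul_left,
    inner_smul_right, inner_zero_right, ← s, w, Complex.conj_I, Complex.conj_ofReal,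
    ← HilbertBasis.repr_apply_apply] at r l h0' h1'
  constructor
  · linear_combination h0' - l
  · linear_combination h1' - r

/-- Cramer's rule: the first equation at n + 1 and the second at n involve the same two coefficients
with the same square root r, and the hypothesis says that their determinant is non-zero. -/
theorem IsWeightBasis.repr_eq_zero {q τ : ℝ} (hq : 1 / 4 ≤ q) {f : HilbertBasis ℤ ℂ V}
    (hf : IsWeightBasis π q τ f) {ψ : Fin 2 → V} (hψ : ψ ∈ diracCohomology π) {n : ℤ}
    (hn : q + 2 * (τ + n) * (τ + n + 1) ≠ 0) :
    f.repr (ψ 0) (n + 1) = 0 ∧ f.repr (ψ 1) n = 0 := by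
  have h1 := (hf.repr_eq hψ (n + 1)).1
  have h2 := (hf.repr_eq hψ n).2
  -- With m = τ + n, the radicand is (q - 1/4) + (m + 1/2)².
  have hr : 0 ≤ q + (τ + n) * (τ + n + 1) := by nlinarith [sq_nonneg (τ + n + 1 / 2)]
  have e : q + (τ + ((n + 1 : ℤ) : ℝ)) * (τ + ((n + 1 : ℤ) : ℝ) - 1)
      = q + (τ + n) * (τ + n + 1) := by push_cast; ring
  rw [e, add_sub_cancel_right] at h1
  have hs := congrArg (fun x : ℝ => (x : ℂ)) (Real.sq_sqrt hr)
  have hn' : ((q + 2 * (τ + n) * (τ + n + 1) : ℝ) : ℂ) ≠ 0 := Complex.ofReal_ne_zero.mpr hn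
  generalize √(q + (τ + n) * (τ + n + 1)) = r at *
  push_cast at h1 h2 hs hn'
  constructor
  · refine (mul_eq_zero.mp ?_).resolve_left hn'
    linear_combination (r : ℂ) * h2 + (τ + n) * h1 - f.repr (ψ 0) (n + 1) * hs
  · refine (mul_eq_zero.mp ?_).resolve_left hn'
    linear_combination (r : ℂ) * h1 - (τ + n + 1) * h2 - f.repr (ψ 1) n * hs

/-- On the parabola q = 1/2 - 2(τ - 1/2)², so q ≥ 1/4 is the same as (τ - 1/2)² ≤ 1/8: the arc is
exactly the piece of the parabola inside the parameter set. -/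
theorem mem_parabolicArc_iff {q τ : ℝ} :
    (q, τ) ∈ parabolicArc ↔ q + 2 * τ * (τ - 1) = 0 ∧ 1 / 4 ≤ q := by
  have h8 : (0 : ℝ) < √8 := Real.sqrt_pos.mpr (by norm_num)
  have hs0 : 0 < 1 / √8 := one_div_pos.mpr h8
  have hs : (1 / √8) ^ 2 = 1 / 8 := by rw [div_pow, Real.sq_sqrt (by norm_num)]; norm_num
  change (q + 2 * τ * (τ - 1) = 0 ∧ τ ∈ Icc (1 / 2 - 1 / √8) (1 / 2 + 1 / √8)) ↔ _
  refine and_congr_right fun h => ?_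
  generalize 1 / √8 = s at *
  rw [mem_Icc]
  constructor
  · rintro ⟨h1, h2⟩
    nlinarith [mul_nonneg (sub_nonneg.mpr h1) (sub_nonneg.mpr h2)]
  · intro h1
    have h2 : |τ - 1 / 2| ≤ s := abs_le_of_sq_le_sq (by nlinarith) hs0.le
    rw [abs_le] at h2
    constructor <;> linarith [h2.1, h2.2]

theorem bounds_of_mem_parabolicArc {q τ : ℝ} (h : (q, τ) ∈ parabolicArc) :
    1 / 4 ≤ q ∧ 0 < τ ∧ τ < 1 := by
  rw [mem_parabolicArc_iff] at h
  refine ⟨h.2, ?_, ?_⟩ <;> by_contra! h' <;> nlinarith [h.1, h.2]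

/-- With m = τ + n, vanishing forces m(m + 1) = -q/2 < 0, hence -1 < m < 0; but m ≥ 0 for n ≥ 0 and
m ≤ -1 for n ≤ -2. -/
theorem weight_eq_of_det_eq_zero {q τ : ℝ} (hq : 1 / 4 ≤ q) (h0 : 0 ≤ τ) (h1 : τ ≤ 1) {n : ℤ}
    (hn : q + 2 * (τ + n) * (τ + n + 1) = 0) : n = -1 := by
  by_contra h
  rcases (by omega : 0 ≤ n ∨ n ≤ -2) with h' | h'
  · have h2 : (0 : ℝ) ≤ n := by exact_mod_cast h'
    nlinarith [mul_nonneg (add_nonneg h0 h2) (add_nonneg h0 h2)]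
  · have h2 : (n : ℝ) ≤ -2 := by exact_mod_cast h'
    have h3 : τ + n + 1 ≤ 0 := by linarith
    nlinarith

theorem IsWeightBasis.diracCohomology_eq_bot {q τ : ℝ} (hq : 1 / 4 ≤ q) (h0 : 0 ≤ τ)
    (h1 : τ ≤ 1) {f : HilbertBasis ℤ ℂ V} (hf : IsWeightBasis π q τ f)
    (hn : (q, τ) ∉ parabolicArc) : diracCohomology π = ⊥ := by
  rw [eq_bot_iff]
  intro ψ hψ
  have h : ∀ n : ℤ, q + 2 * (τ + n) * (τ + n + 1) ≠ 0 := fun n hz => hn <| by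
    obtain rfl := weight_eq_of_det_eq_zero hq h0 h1 hz
    rw [mem_parabolicArc_iff]
    push_cast at hz
    exact ⟨by linear_combination hz, hq⟩
  rw [Submodule.mem_bot, funext_iff, Fin.forall_fin_two]
  constructor <;> refine f.repr.map_eq_zero_iff.mp (lp.ext (funext fun n => ?_))
  · simpa using (hf.repr_eq_zero hq hψ (h (n - 1))).1
  · simpa using (hf.repr_eq_zero hq hψ (h n)).2

/-- On the arc q + τ(τ - 1) = τ(1 - τ), so the square root in the surviving system factors as √τ √(1
- τ). Dividing the first equation by √τ leaves √τ a + √(1 - τ) b = 0. -/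
theorem IsWeightBasis.diracCohomology_eq_span {q τ : ℝ} (harc : (q, τ) ∈ parabolicArc)
    {f : HilbertBasis ℤ ℂ V} (hf : IsWeightBasis π q τ f) :
    diracCohomology π
      = Submodule.span ℂ {![((√(1 - τ) : ℝ) : ℂ) • f 0, -((√τ : ℝ) : ℂ) • f (-1)]} := by
  obtain ⟨hq, h0, h1⟩ := bounds_of_mem_parabolicArc harc
  have hqe := (mem_parabolicArc_iff.mp harc).1
  have hτ := Real.sq_sqrt h0.le
  have hτ' := Real.sq_sqrt (sub_pos.mpr h1).le
  have hpos : 0 < √τ := Real.sqrt_pos.mpr h0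
  have hpos' : 0 < √(1 - τ) := Real.sqrt_pos.mpr (sub_pos.mpr h1)
  have hsq : √(q + τ * (τ - 1)) = √τ * √(1 - τ) := by
    rw [← Real.sqrt_mul h0.le]
    congr 1
    linear_combination hqe
  have hsq' : √(q + (τ - 1) * (τ - 1 + 1)) = √τ * √(1 - τ) := by
    rw [← hsq]; congr 1; ring
  have hx : ((√τ : ℝ) : ℂ) ≠ 0 := Complex.ofReal_ne_zero.mpr hpos.ne'
  have hy : ((√(1 - τ) : ℝ) : ℂ) ≠ 0 := Complex.ofReal_ne_zero.mpr hpos'.ne'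
  have hτc := congrArg (fun x : ℝ => (x : ℂ)) hτ
  have hτc' := congrArg (fun x : ℝ => (x : ℂ)) hτ'
  refine le_antisymm (fun ψ hψ => ?_) ?_
  · have ha : ∀ n : ℤ, n ≠ 0 → f.repr (ψ 0) n = 0 := fun n hn => by
      have := (hf.repr_eq_zero hq hψ (n := n - 1) fun hz =>
        hn (by have := weight_eq_of_det_eq_zero hq h0.le h1.le hz; omega)).1
      simpa using this
    have hb : ∀ n : ℤ, n ≠ -1 → f.repr (ψ 1) n = 0 := fun n hn =>
      (hf.repr_eq_zero hq hψ (n := n) fun hz => hn (weight_eq_of_det_eq_zero hq h0.le h1.le hz)).2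
    have h2 := (hf.repr_eq hψ 0).1
    simp only [Int.cast_zero, add_zero, zero_sub, hsq] at h2
    have h3 : ((√τ : ℝ) : ℂ) * f.repr (ψ 0) 0 + ((√(1 - τ) : ℝ) : ℂ) * f.repr (ψ 1) (-1) = 0 := by
      refine (mul_eq_zero.mp ?_).resolve_left hx
      push_cast at h2 hτc ⊢
      linear_combination h2 + f.repr (ψ 0) 0 * hτc
    rw [Submodule.mem_span_singleton]
    refine ⟨f.repr (ψ 0) 0 / ((√(1 - τ) : ℝ) : ℂ), ?_⟩
    rw [funext_iff, Fin.forall_fin_two]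
    constructor <;> refine f.repr.injective (lp.ext (funext fun n => ?_))
    · simp only [Pi.smul_apply, Matrix.cons_val_zero, map_smul, lp.coeFn_smul, smul_eq_mul,
        f.repr_self]
      rw [← mul_assoc, div_mul_cancel₀ _ hy]
      by_cases hn : n = 0
      · subst hn; simp
      · rw [ha n hn]; simp [hn]
    · simp only [Pi.smul_apply, Matrix.cons_val_one, Matrix.cons_val_fin_one, map_smul,
        lp.coeFn_smul, smul_eq_mul, f.repr_self]
      by_cases hn : n = -1
      · subst hn
        simp only [lp.single_apply_self, mul_one]
        field_simp
        linear_combination -h3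
      · rw [hb n hn]; simp [hn]
  · rw [Submodule.span_singleton_le_iff_mem, mem_diracCohomology]
    have hm : ∀ (a : Fin 2) k, (![((√(1 - τ) : ℝ) : ℂ) • f 0, -((√τ : ℝ) : ℂ) • f (-1)] :
        Fin 2 → V) a ∈ (generator π k).domain := by
      rw [Fin.forall_fin_two]
      exact ⟨fun k => Submodule.smul_mem _ _ (hf.mem 0 k),
        fun k => Submodule.smul_mem _ _ (hf.mem (-1) k)⟩
    refine ⟨hm, ?_⟩
    have e0 : ∀ k, generator π k ⟨_, hm 0 k⟩
        = ((√(1 - τ) : ℝ) : ℂ) • generator π k ⟨f 0, hf.mem 0 k⟩ := fun k =>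
      (generator π k).map_smul _ ⟨f 0, hf.mem 0 k⟩
    have e1 : ∀ k, generator π k ⟨_, hm 1 k⟩
        = (-((√τ : ℝ) : ℂ)) • generator π k ⟨f (-1), hf.mem (-1) k⟩ := fun k =>
      (generator π k).map_smul _ ⟨f (-1), hf.mem (-1) k⟩
    simp only [e0, e1]
    have w0 := hf.weight 0
    have w1 := hf.weight (-1)
    have l0 := hf.lower 0
    have r1 := hf.raise (-1)
    simp only [Int.cast_zero, add_zero, zero_sub, hsq, Int.cast_neg, Int.cast_one,
      ← sub_eq_add_neg, hsq', neg_add_cancel] at w0 w1 l0 r1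
    rw [w0, w1, smul_comm I, smul_comm I, ← smul_add, ← smul_sub, r1, l0, smul_smul, smul_smul,
      smul_smul, smul_smul, ← add_smul, ← sub_smul]
    push_cast at hτc hτc' ⊢
    constructor
    · rw [show ((√(1 - τ) : ℝ) : ℂ) * τ + -((√τ : ℝ) : ℂ) * (((√τ : ℝ) : ℂ) * ((√(1 - τ) : ℝ) : ℂ))
        = 0 by linear_combination -((√(1 - τ) : ℝ) : ℂ) * hτc, zero_smul]
    · rw [show ((√(1 - τ) : ℝ) : ℂ) * (((√τ : ℝ) : ℂ) * ((√(1 - τ) : ℝ) : ℂ))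
        - -((√τ : ℝ) : ℂ) * (τ - 1) = 0 by linear_combination ((√τ : ℝ) : ℂ) * hτc', zero_smul]

theorem IsWeightBasis.finrank_diracCohomology {q τ : ℝ} (harc : (q, τ) ∈ parabolicArc)
    {f : HilbertBasis ℤ ℂ V} (hf : IsWeightBasis π q τ f) :
    Module.finrank ℂ (diracCohomology π) = 1 := by
  rw [hf.diracCohomology_eq_span harc]
  refine finrank_span_singleton fun h => ?_
  obtain ⟨hq, h0, h1⟩ := bounds_of_mem_parabolicArc harc
  have h2 := congrFun h 0
  simp only [Matrix.cons_val_zero, Pi.zero_apply, smul_eq_zero, Complex.ofReal_eq_zero] at h2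
  exact h2.elim (Real.sqrt_pos.mpr (sub_pos.mpr h1)).ne' (f.orthonormal.ne_zero 0)

theorem IsWeightBasis.diracCohomology_ne_bot_iff {q τ : ℝ} (hq : 1 / 4 ≤ q) (h0 : 0 ≤ τ)
    (h1 : τ ≤ 1) {f : HilbertBasis ℤ ℂ V} (hf : IsWeightBasis π q τ f) :
    diracCohomology π ≠ ⊥ ↔ (q, τ) ∈ parabolicArc := by
  constructor
  · exact fun h => by_contra fun hn => h (hf.diracCohomology_eq_bot hq h0 h1 hn)
  · intro h hb
    have := hf.finrank_diracCohomology h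
    rw [hb, finrank_bot] at this
    exact zero_ne_one this

end Abstract

/-! ### The principal series generators on Fourier monomials. -/

/-- The fundamental theorem of calculus upgrades pointwise to uniform differentiability: Φ is Φ 0
plus the integral of Φ' in the Banach space C(X), and a continuous integrand can be recovered by
differentiation. -/
theorem ContinuousMap.hasDerivAt_of_eval {X : Type*} [TopologicalSpace X] [CompactSpace X]
    {Φ Φ' : ℝ → C(X, ℂ)} (hc : Continuous Φ')
    (h : ∀ s x, HasDerivAt (fun s => Φ s x) (Φ' s x) s) (s : ℝ) : HasDerivAt Φ (Φ' s) s := by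
  have e : Φ = fun s => Φ 0 + ∫ u in (0 : ℝ)..s, Φ' u := by
    funext s
    ext x
    have h1 := (ContinuousMap.evalCLM ℝ x).intervalIntegral_comp_comm
      (hc.intervalIntegrable (μ := volume) 0 s)
    simp only [ContinuousMap.evalCLM_apply] at h1
    rw [ContinuousMap.add_apply, ← h1, intervalIntegral.integral_eq_sub_of_hasDerivAt
      (fun u _ => h u x)
      (((ContinuousMap.evalCLM ℝ x).continuous.comp hc).intervalIntegrable 0 s)]
    ring
  rw [e]
  exact (intervalIntegral.integral_hasDerivAt_right (hc.intervalIntegrable 0 s)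
    (hc.stronglyMeasurableAtFilter _ _) hc.continuousAt).const_add _

theorem continuous_circlePt : Continuous circlePt :=
  continuous_subtype_val.comp AddCircle.continuous_toCircle

theorem fourier_eq_circlePt_zpow (n : ℤ) (x : AddCircle (2 * Real.pi)) :
    fourier n x = circlePt x ^ n := by
  rw [fourier_apply, AddCircle.toCircle_zsmul, Circle.coe_zpow, circlePt]

/-- The derivative at `t = 0` of the logarithm of the automorphy factor along `exp(t X_k)`. -/
noncomputable def logjDeriv (k : Fin 3) (z : ℂ) : ℂ :=
  if k = 0 then -(I / 2) else hypDir k * z / 2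

theorem hasDerivAt_half (f f' : ℝ → ℝ) (hf : ∀ x, HasDerivAt f (f' x) x) (s : ℝ) :
    HasDerivAt (fun s : ℝ => ((f (s / 2) : ℝ) : ℂ)) ((f' (s / 2) / 2 : ℝ) : ℂ) s := by
  have h1 : HasDerivAt (fun s : ℝ => s / 2) (1 / 2) s := (hasDerivAt_id s).div_const 2
  have h2 := ((hf (s / 2)).comp s h1).ofReal_comp
  simpa [div_eq_mul_inv] using h2

theorem hasDerivAt_logj_oneParam {k : Fin 3} (hk : k ≠ 0) {z : ℂ} (hz : ‖z‖ ≤ 1) (s : ℝ) :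
    HasDerivAt (fun s => (oneParam k s).logj z)
      (((Real.sinh (s / 2) / 2 : ℝ) + hypDir k * z * (Real.cosh (s / 2) / 2 : ℝ))
        / j (oneParam k s).mat z) s := by
  have h1 := (hasDerivAt_half _ _ Real.hasDerivAt_cosh s).add
    ((hasDerivAt_half _ _ Real.hasDerivAt_sinh s).const_mul (hypDir k * z))
  have h2 : HasDerivAt (fun s => j (oneParam k s).mat z)
      ((Real.sinh (s / 2) / 2 : ℝ) + hypDir k * z * (Real.cosh (s / 2) / 2 : ℝ)) s :=
    h1.congr_of_eventuallyEq (.of_forall fun t => j_oneParam hk t z)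
  exact (h2.clog_real (.inl (j_oneParam_re_pos hk s hz))).congr_of_eventuallyEq
    (.of_forall fun t => logj_oneParam hk t hz)

/-- Joint continuity in time and position is what currying turns into continuity of curves in
C(circle), as `ContinuousMap.hasDerivAt_of_eval` requires. -/
theorem exists_deriv_logj_circlePt (k : Fin 3) :
    ∃ L' : ℝ → AddCircle (2 * Real.pi) → ℂ, Continuous (Function.uncurry L') ∧
      Continuous (Function.uncurry fun s x => (oneParam k s).logj (circlePt x)) ∧
      (∀ s x, HasDerivAt (fun s => (oneParam k s).logj (circlePt x)) (L' s x) s) ∧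
      ∀ x, L' 0 x = logjDeriv k (circlePt x) := by
  by_cases hk : k = 0
  · subst hk
    refine ⟨fun _ _ => -(I / 2), continuous_const, ?_, fun s x => ?_, fun x => by simp [logjDeriv]⟩
    · simp only [logj_oneParam_zero, Function.uncurry_def]
      fun_prop
    · simp only [logj_oneParam_zero]
      have := ((hasDerivAt_half id 1 hasDerivAt_id s).mul_const I).fun_neg
      refine this.congr_deriv ?_
      simp; ring
  · have hcz : Continuous fun p : ℝ × AddCircle (2 * Real.pi) => circlePt p.2 :=
      continuous_circlePt.comp continuous_snd
    have hcosh : Continuous fun p : ℝ × AddCircle (2 * Real.pi) =>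
        ((Real.cosh (p.1 / 2) : ℝ) : ℂ) := Complex.continuous_ofReal.comp
      (Real.continuous_cosh.comp (continuous_fst.div_const 2))
    have hsinh : Continuous fun p : ℝ × AddCircle (2 * Real.pi) =>
        ((Real.sinh (p.1 / 2) : ℝ) : ℂ) := Complex.continuous_ofReal.comp
      (Real.continuous_sinh.comp (continuous_fst.div_const 2))
    have hj : Continuous fun p : ℝ × AddCircle (2 * Real.pi) =>
        j (oneParam k p.1).mat (circlePt p.2) := by
      simp only [j_oneParam hk]
      exact hcosh.add ((continuous_const.mul hcz).mul hsinh)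
    refine ⟨fun s x => ((Real.sinh (s / 2) / 2 : ℝ)
      + hypDir k * circlePt x * (Real.cosh (s / 2) / 2 : ℝ)) / j (oneParam k s).mat (circlePt x),
      ?_, ?_, fun s x => hasDerivAt_logj_oneParam hk (norm_circlePt x).le s, fun x => ?_⟩
    · refine Continuous.div ?_ hj fun p => j_ne_zero _ (norm_circlePt p.2).le
      simp only [Complex.ofReal_div]
      exact (hsinh.div_const _).add ((continuous_const.mul hcz).mul (hcosh.div_const _))
    · simp only [Function.uncurry_def, logj_oneParam hk _ (norm_circlePt _).le]
      exact hj.clog fun p => .inl (j_oneParam_re_pos hk _ (norm_circlePt p.2).le)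
    · simp [j_oneParam hk, logjDeriv, hk]
      ring

/-- The image of `z^n` under `g⁻¹` in the principal series, in terms of `log j` and its conjugate. -/
theorem principalMult_mul_fourier (σ τ : ℝ) (n : ℤ) (g : SL2Cover) (x : AddCircle (2 * Real.pi)) :
    principalMult σ τ g x * fourier n (g.circleAct x)
      = Complex.exp (-(1 / 2 + I * σ + (τ + n)) * g.logj (circlePt x)
        - (1 / 2 + I * σ - (τ + n)) * conj (g.logj (circlePt x))) * fourier n x := by
  have h1 : fourier n (g.circleAct x)
      = Complex.exp (-(2 * n * I * (g.logj (circlePt x)).im)) * fourier n x := by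
    rw [fourier_eq_circlePt_zpow, fourier_eq_circlePt_zpow, circleAct, sub_eq_add_neg,
      ← AddCircle.coe_neg, circlePt, AddCircle.toCircle_add, Circle.coe_mul, mul_zpow, mul_comm]
    congr 1
    change circlePt _ ^ n = _
    rw [circlePt_coe, ← Complex.exp_int_mul]
    congr 1
    push_cast
    ring
  rw [h1, ← mul_assoc, principalMult, ← Complex.exp_add]
  congr 2
  generalize g.logj (circlePt x) = w
  have h2 : w = w.re + w.im * I := (Complex.re_add_im w).symm
  have h3 : conj w = w.re - w.im * I := Complex.ext (by simp) (by simp)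
  rw [h3]
  conv_rhs => rw [h2]
  simp only [Complex.add_re, Complex.add_im, Complex.ofReal_re, Complex.ofReal_im, Complex.mul_re,
    Complex.mul_im, Complex.I_re, Complex.I_im]
  push_cast
  ring

theorem principalSeries_fourier (q τ : ℝ) (n : ℤ) (g : SL2Cover)
    (Φ : C(AddCircle (2 * Real.pi), ℂ)) (hΦ : ∀ x, Φ x
      = Complex.exp (-(1 / 2 + I * √(q - 1 / 4) + (τ + n)) * g⁻¹.logj (circlePt x)
        - (1 / 2 + I * √(q - 1 / 4) - (τ + n)) * conj (g⁻¹.logj (circlePt x))) * fourier n x) :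
    principalSeries q τ g (fourierLp 2 n)
      = ContinuousMap.toLp 2 AddCircle.haarAddCircle ℂ Φ := by
  refine Lp.ext ?_
  filter_upwards [(principalAction √(q - 1 / 4) τ).coeFn_rep g (fourierLp 2 n),
    ((principalAction √(q - 1 / 4) τ).quasi g⁻¹).ae (coeFn_fourierLp 2 n),
    ContinuousMap.coeFn_toLp (p := 2) (𝕜 := ℂ) AddCircle.haarAddCircle Φ] with x h1 h2 h3
  rw [h3, hΦ, ← principalMult_mul_fourier]
  refine h1.trans ?_
  rw [h2]
  rfl

/-- The orbit of z^n is a C¹ curve of continuous functions, and the inclusion of C(circle) into L²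
is continuous and linear, so the uniform derivative is also the L² derivative. -/
theorem hasDerivAt_principalSeries_fourier (q τ : ℝ) (n : ℤ) (k : Fin 3)
    (Φ : C(AddCircle (2 * Real.pi), ℂ)) (hΦ : ∀ x, Φ x
      = ((1 / 2 + I * √(q - 1 / 4) + (τ + n)) * logjDeriv k (circlePt x)
        + (1 / 2 + I * √(q - 1 / 4) - (τ + n)) * conj (logjDeriv k (circlePt x)))
          * fourier n x) :
    HasDerivAt (fun t : ℝ => principalSeries q τ (oneParam k t) (fourierLp 2 n))
      (ContinuousMap.toLp 2 AddCircle.haarAddCircle ℂ Φ) 0 := by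
  obtain ⟨L', hL', hL, hd, h0⟩ := exists_deriv_logj_circlePt k
  set a : ℂ := 1 / 2 + I * √(q - 1 / 4) + (τ + n)
  set b : ℂ := 1 / 2 + I * √(q - 1 / 4) - (τ + n)
  set L : ℝ → AddCircle (2 * Real.pi) → ℂ := fun s x => (oneParam k s).logj (circlePt x)
  have hF : Continuous fun p : ℝ × AddCircle (2 * Real.pi) => fourier n p.2 :=
    (fourier n).continuous.comp continuous_snd
  have hE : Continuous fun p : ℝ × AddCircle (2 * Real.pi) =>
      Complex.exp (-a * L p.1 p.2 - b * conj (L p.1 p.2)) * fourier n p.2 :=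
    (Complex.continuous_exp.comp ((continuous_const.mul hL).sub
      (continuous_const.mul (Complex.continuous_conj.comp hL)))).mul hF
  have hE' : Continuous fun p : ℝ × AddCircle (2 * Real.pi) =>
      (-a * L' p.1 p.2 - b * conj (L' p.1 p.2)) *
      (Complex.exp (-a * L p.1 p.2 - b * conj (L p.1 p.2)) * fourier n p.2) :=
    ((continuous_const.mul hL').sub
      (continuous_const.mul (Complex.continuous_conj.comp hL'))).mul hE
  let Ψ : C(ℝ × AddCircle (2 * Real.pi), ℂ) := ⟨_, hE⟩
  let Ψ' : C(ℝ × AddCircle (2 * Real.pi), ℂ) := ⟨_, hE'⟩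
  have h1 : HasDerivAt (fun s => Ψ.curry s) (Ψ'.curry 0) 0 := by
    refine ContinuousMap.hasDerivAt_of_eval Ψ'.curry.continuous (fun s x => ?_) 0
    have h2 : HasDerivAt (fun s => conj (L s x)) (conj (L' s x)) s :=
      Complex.conjCLE.toContinuousLinearMap.hasFDerivAt.comp_hasDerivAt s (hd s x)
    have h3 := ((((hd s x).const_mul (-a)).fun_sub (h2.const_mul b)).cexp).mul_const (fourier n x)
    exact h3.congr_deriv (by simp only [Ψ', ContinuousMap.curry_apply, ContinuousMap.coe_mk, L]; ring)
  have h4 : HasDerivAt (fun s => ContinuousMap.toLp 2 AddCircle.haarAddCircle ℂ (Ψ.curry s))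
      (ContinuousMap.toLp 2 AddCircle.haarAddCircle ℂ (Ψ'.curry 0)) 0 :=
    HasFDerivAt.comp_hasDerivAt (0 : ℝ) ((ContinuousMap.toLp (E := ℂ) 2
      (AddCircle.haarAddCircle (T := 2 * Real.pi)) ℂ).restrictScalars ℝ).hasFDerivAt h1
  -- The representation evaluates the multiplier at the inverse, exp(-tX), so the derivative changes
  -- sign.
  have h5 := HasDerivAt.scomp (0 : ℝ) (by simpa using h4) (hasDerivAt_neg (0 : ℝ))
  have h6 : (-1 : ℝ) • ContinuousMap.toLp 2 AddCircle.haarAddCircle ℂ (Ψ'.curry 0)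
      = ContinuousMap.toLp 2 AddCircle.haarAddCircle ℂ Φ := by
    rw [neg_one_smul, ← map_neg]
    congr 1
    ext x
    have hL0 : L 0 x = 0 := by simp only [L, oneParam_at_zero, logj_one]
    simp only [ContinuousMap.neg_apply, Ψ', ContinuousMap.curry_apply, ContinuousMap.coe_mk, hΦ,
      hL0, h0]
    simp
    ring
  rw [h6] at h5
  refine h5.congr_of_eventuallyEq (.of_forall fun t => ?_)
  refine principalSeries_fourier q τ n _ _ fun x => ?_
  rw [oneParam_inv]
  rfl

section

variable (q τ : ℝ) (n : ℤ)

theorem mem_domain_fourier (k : Fin 3) :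
    fourierLp 2 n ∈ (generator (principalSeries q τ) k).domain := by
  have hc : Continuous fun x : AddCircle (2 * Real.pi) => logjDeriv k (circlePt x) := by
    unfold logjDeriv
    have := continuous_circlePt
    split_ifs <;> fun_prop
  exact mem_generator_domain.mpr (hasDerivAt_principalSeries_fourier q τ n k
    ⟨_, ((continuous_const.mul hc).add (continuous_const.mul
      (Complex.continuous_conj.comp hc))).mul (fourier n).continuous⟩ fun x => rfl
    ).differentiableAt

theorem generator_zero_fourier :
    generator (principalSeries q τ) 0 ⟨fourierLp 2 n, mem_domain_fourier q τ n 0⟩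
      = ((τ + n : ℝ) : ℂ) • fourierLp 2 n := by
  have h := hasDerivAt_principalSeries_fourier q τ n 0 ((-(I * (τ + n))) • fourier n) fun x => by
    simp [logjDeriv, Complex.conj_ofNat]
    ring
  rw [generator_eq_of_hasDerivAt h, map_smul, smul_smul]
  congr 1
  push_cast
  linear_combination -(τ + n : ℂ) * Complex.I_mul_I

theorem circlePt_mul_fourier (x : AddCircle (2 * Real.pi)) :
    circlePt x * fourier n x = fourier (n + 1) x := by
  rw [add_comm, fourier_add, fourier_one, circlePt]

theorem conj_circlePt_mul_fourier (x : AddCircle (2 * Real.pi)) :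
    conj (circlePt x) * fourier n x = fourier (n - 1) x := by
  rw [sub_eq_neg_add, fourier_add, fourier_neg, fourier_one, circlePt]

theorem generator_one_fourier :
    generator (principalSeries q τ) 1 ⟨fourierLp 2 n, mem_domain_fourier q τ n 1⟩
      = (-(1 / 2 + I * √(q - 1 / 4) + (τ + n)) / 2) • fourierLp 2 (n + 1)
        + ((1 / 2 + I * √(q - 1 / 4) - (τ + n)) / 2) • fourierLp 2 (n - 1) := by
  have h := hasDerivAt_principalSeries_fourier q τ n 1
    ((I * (1 / 2 + I * √(q - 1 / 4) + (τ + n)) / 2) • fourier (n + 1)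
      + (-I * (1 / 2 + I * √(q - 1 / 4) - (τ + n)) / 2) • fourier (n - 1)) fun x => by
    simp only [ContinuousMap.add_apply, ContinuousMap.smul_apply, ← circlePt_mul_fourier,
      ← conj_circlePt_mul_fourier, logjDeriv, hypDir, smul_eq_mul, one_ne_zero, if_false, map_div₀,
      map_mul, Complex.conj_I, Complex.conj_ofNat]
    ring
  rw [generator_eq_of_hasDerivAt h, map_add, map_smul, map_smul, smul_add, smul_smul, smul_smul]
  congr 2
  · linear_combination ((1 / 2 + I * √(q - 1 / 4) + (τ + n)) / 2) * Complex.I_mul_I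
  · linear_combination -((1 / 2 + I * √(q - 1 / 4) - (τ + n)) / 2) * Complex.I_mul_I

theorem generator_two_fourier :
    I • generator (principalSeries q τ) 2 ⟨fourierLp 2 n, mem_domain_fourier q τ n 2⟩
      = (-(1 / 2 + I * √(q - 1 / 4) + (τ + n)) / 2) • fourierLp 2 (n + 1)
        - ((1 / 2 + I * √(q - 1 / 4) - (τ + n)) / 2) • fourierLp 2 (n - 1) := by
  have h := hasDerivAt_principalSeries_fourier q τ n 2
    (((1 / 2 + I * √(q - 1 / 4) + (τ + n)) / 2) • fourier (n + 1)
      + ((1 / 2 + I * √(q - 1 / 4) - (τ + n)) / 2) • fourier (n - 1)) fun x => by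
    simp only [ContinuousMap.add_apply, ContinuousMap.smul_apply, ← circlePt_mul_fourier,
      ← conj_circlePt_mul_fourier, logjDeriv, hypDir, smul_eq_mul, map_div₀,
      map_mul, Complex.conj_ofNat, map_one, show (2 : Fin 3) ≠ 0 by decide, if_false]
    ring
  rw [generator_eq_of_hasDerivAt h, smul_smul, Complex.I_mul_I, map_add, map_smul, map_smul,
    neg_one_smul, neg_add, ← neg_smul, ← sub_eq_add_neg, neg_div]

theorem raise_fourier :
    generator (principalSeries q τ) 1 ⟨fourierLp 2 n, mem_domain_fourier q τ n 1⟩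
        + I • generator (principalSeries q τ) 2 ⟨fourierLp 2 n, mem_domain_fourier q τ n 2⟩
      = (-(1 / 2 + I * √(q - 1 / 4) + (τ + n))) • fourierLp 2 (n + 1) := by
  rw [generator_one_fourier, generator_two_fourier]
  module

theorem lower_fourier :
    generator (principalSeries q τ) 1 ⟨fourierLp 2 n, mem_domain_fourier q τ n 1⟩
        - I • generator (principalSeries q τ) 2 ⟨fourierLp 2 n, mem_domain_fourier q τ n 2⟩
      = (1 / 2 + I * √(q - 1 / 4) - (τ + n)) • fourierLp 2 (n - 1) := by
  rw [generator_one_fourier, generator_two_fourier]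
  module

end

/-! ### Phases and the normalised weight basis. -/

/-- Unit complex numbers with prescribed quotients along `ℤ`. -/
theorem exists_norm_one_int (r : ℤ → ℂ) (hr : ∀ n, ‖r n‖ = 1) :
    ∃ u : ℤ → ℂ, (∀ n, ‖u n‖ = 1) ∧ ∀ n, u (n + 1) = r n * u n := by
  let w : ℤ → Circle := fun n => ⟨r n, by simp [Submonoid.unitSphere, hr n]⟩
  -- One of the two products is always empty: the first serves n ≥ 0, the second n < 0.
  refine ⟨fun n => ((∏ i ∈ Finset.Ico 0 n, w i) / ∏ i ∈ Finset.Ico n 0, w i : Circle),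
    fun n => Circle.norm_coe _, fun n => ?_⟩
  have hw : r n = w n := rfl
  rw [hw, ← Circle.coe_mul]
  refine congrArg ((↑) : Circle → ℂ) ?_
  rcases le_or_gt 0 n with h | h
  · rw [Finset.Ico_eq_empty_of_le (show (0 : ℤ) ≤ n + 1 by omega), Finset.Ico_eq_empty_of_le h,
      ← Finset.insert_Ico_right_eq_Ico_add_one h, Finset.prod_insert (by simp)]
    simp
    rfl
  · rw [Finset.Ico_eq_empty_of_le (show n + 1 ≤ 0 by omega), Finset.Ico_eq_empty_of_le h.le,
      ← Finset.insert_Ico_add_one_left_eq_Ico h, Finset.prod_insert (by simp)]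
    simp
    rfl

/-- With σ² = q - 1/4, raising multiplies z^n by a_n = -(1/2 + iσ + τ + n), and |a_n|² = σ² + (τ + n
+ 1/2)² is the required radicand. Phases u_n with u_{n+1} |a_n| = a_n u_n make the raising
coefficients non-negative; the lowering coefficients are conjugate to them and are corrected by the
same phases. -/
theorem exists_isWeightBasis {q : ℝ} (τ : ℝ) (hq : 1 / 4 ≤ q) :
    ∃ f, IsWeightBasis (principalSeries q τ) q τ f := by
  set a : ℤ → ℂ := fun n => -(1 / 2 + I * √(q - 1 / 4) + (τ + n)) with ha
  have hσ := Real.sq_sqrt (sub_nonneg.mpr hq)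
  have hsq : ∀ n : ℤ, √(q + (τ + n) * (τ + n + 1)) = ‖a n‖ := fun n => by
    rw [Complex.norm_def, Complex.normSq_apply]
    congr 1
    simp only [a, Complex.neg_re, Complex.neg_im, Complex.add_re, Complex.add_im, Complex.mul_re,
      Complex.mul_im, Complex.I_re, Complex.I_im, Complex.ofReal_re, Complex.ofReal_im,
      Complex.intCast_re, Complex.intCast_im, Complex.div_ofNat_re, Complex.div_ofNat_im,
      Complex.one_re, Complex.one_im]
    linear_combination -hσ
  have hb : ∀ n : ℤ, 1 / 2 + I * √(q - 1 / 4) - (τ + n) = conj (a (n - 1)) := fun n => by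
    simp [a, Complex.conj_ofNat]; ring
  -- If a n = 0 any phase will do, since both ladder coefficients vanish.
  obtain ⟨u, hu, hrec⟩ := exists_norm_one_int (fun n => if a n = 0 then 1 else a n / ‖a n‖)
    fun n => by
      split_ifs with h
      · simp
      · simp [h]
  have hrec' : ∀ n, u (n + 1) * ‖a n‖ = a n * u n := fun n => by
    rw [hrec]
    split_ifs with h
    · simp [h]
    · have : (‖a n‖ : ℂ) ≠ 0 := by simpa using h
      field_simp
  have huc : ∀ n, conj (u n) * u n = 1 := fun n => by
    rw [mul_comm, Complex.mul_conj', hu]; simp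
  -- This is the conjugate of `hrec'` multiplied by u (n + 1) u n.
  have hrec'' : ∀ n, u (n + 1) * conj (a n) = ‖a n‖ * u n := fun n => by
    have h := congrArg conj (hrec' n)
    simp only [map_mul, Complex.conj_ofReal] at h
    linear_combination (-(u (n + 1) * u n)) * h + (u n * ‖a n‖) * huc (n + 1)
      - (u (n + 1) * conj (a n)) * huc n
  have hon : Orthonormal ℂ fun n => u n • (fourierLp 2 n :
      Lp ℂ 2 (AddCircle.haarAddCircle (T := 2 * Real.pi))) := by
    have h := orthonormal_iff_ite.mp (orthonormal_fourier (T := 2 * Real.pi))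
    rw [orthonormal_iff_ite]
    intro m n
    rw [inner_smul_left, inner_smul_right, h]
    split_ifs with hmn
    · subst hmn; rw [mul_one, huc]
    · simp
  have hun : ∀ n, u n ≠ 0 := fun n h => by simpa [h] using hu n
  have hspan : ⊤ ≤ (Submodule.span ℂ (Set.range fun n => u n • (fourierLp 2 n :
      Lp ℂ 2 (AddCircle.haarAddCircle (T := 2 * Real.pi))))).topologicalClosure := by
    rw [← span_fourierLp_closure_eq_top (T := 2 * Real.pi) (p := 2) (by simp)]
    refine Submodule.topologicalClosure_mono (Submodule.span_le.mpr ?_)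
    rintro _ ⟨n, rfl⟩
    have := Submodule.smul_mem (Submodule.span ℂ (Set.range fun n => u n • (fourierLp 2 n :
      Lp ℂ 2 (AddCircle.haarAddCircle (T := 2 * Real.pi))))) (u n)⁻¹
      (Submodule.subset_span ⟨n, rfl⟩)
    simpa [smul_smul, hun n] using this
  have hf : ∀ n, HilbertBasis.mk hon hspan n = u n • fourierLp 2 n := fun n =>
    congrFun (HilbertBasis.coe_mk hon hspan) n
  have hm : ∀ n k, HilbertBasis.mk hon hspan n ∈ (generator (principalSeries q τ) k).domain :=
    fun n k => hf n ▸ Submodule.smul_mem _ _ (mem_domain_fourier q τ n k)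
  have hg : ∀ n k, generator (principalSeries q τ) k ⟨_, hm n k⟩
      = u n • generator (principalSeries q τ) k ⟨fourierLp 2 n, mem_domain_fourier q τ n k⟩ :=
    fun n k => by
      rw [← LinearPMap.map_smul]
      congr 1
      exact Subtype.ext (hf n)
  refine ⟨HilbertBasis.mk hon hspan, hm, fun n => ?_, fun n => ?_, fun n => ?_⟩
  · rw [hg, generator_zero_fourier, hf, smul_comm]
  · rw [hg, hg, smul_comm I, ← smul_add, raise_fourier, hf, smul_smul, smul_smul, hsq]
    congr 1
    change u n * a n = _
    linear_combination -hrec' n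
  · have e : √(q + (τ + n) * (τ + n - 1)) = ‖a (n - 1)‖ := by
      rw [← hsq]
      push_cast
      congr 1; ring
    have h := hrec'' (n - 1)
    rw [sub_add_cancel] at h
    rw [hg, hg, smul_comm I, ← smul_sub, lower_fourier, hf, smul_smul, smul_smul, e, hb, h]

/-! ### The discrete series generators as differential operators on the disc. -/

open Filter Topology

/-- Difference quotients that converge in L² converge in measure, hence almost everywhere along a
sequence of times, and there the limit is the pointwise derivative. Only countably many times enter,
so their null sets can be united. -/
theorem ae_eq_of_hasDerivAt_Lp {X : Type*} [MeasurableSpace X] {μ : Measure X}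
    {F : ℝ → Lp ℂ 2 μ} {G : Lp ℂ 2 μ} (hF : HasDerivAt F G 0) {φ : ℝ → X → ℂ} {φ' : X → ℂ}
    (hφ : ∀ t, F t =ᵐ[μ] φ t) (hd : ∀ᵐ x ∂μ, HasDerivAt (fun t => φ t x) (φ' x) 0) :
    G =ᵐ[μ] φ' := by
  obtain ⟨ns, hns, hae⟩ :=
    (tendstoInMeasure_of_tendsto_Lp hF.tendsto_slope_zero).exists_seq_tendsto_ae'
  have h1 : ∀ᵐ x ∂μ, ∀ i, ((ns i)⁻¹ • (F (0 + ns i) - F 0) : Lp ℂ 2 μ) x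
      = (ns i)⁻¹ • (φ (0 + ns i) x - φ 0 x) := by
    rw [ae_all_iff]
    intro i
    filter_upwards [Lp.coeFn_smul (ns i)⁻¹ (F (0 + ns i) - F 0),
      Lp.coeFn_sub (F (0 + ns i)) (F 0), hφ (0 + ns i), hφ 0] with x a b c d
    rw [a, Pi.smul_apply, b, Pi.sub_apply, c, d]
  filter_upwards [hae, h1, hd] with x a b c
  simp only [b] at a
  exact tendsto_nhds_unique a (c.tendsto_slope_zero.comp hns)

theorem β_oneParam {k : Fin 3} (hk : k ≠ 0) (t : ℝ) :
    β (oneParam k t).mat = conj (hypDir k) * (Real.sinh (t / 2) : ℝ) := by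
  fin_cases k
  · simp at hk
  · refine (β_oneParam_one t).trans ?_
    simp [hypDir]; ring
  · refine (β_oneParam_two t).trans ?_
    simp [hypDir]

/-- The vector field on the disc generated by `exp(t X_k)`. -/
noncomputable def mobDeriv (k : Fin 3) (z : ℂ) : ℂ :=
  if k = 0 then I * z else (conj (hypDir k) - hypDir k * z ^ 2) / 2

theorem hasDerivAt_logj_oneParam_zero (k : Fin 3) {z : ℂ} (hz : ‖z‖ ≤ 1) :
    HasDerivAt (fun s => (oneParam k s).logj z) (logjDeriv k z) 0 := by
  by_cases hk : k = 0
  · subst hk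
    simp only [logj_oneParam_zero]
    refine ((hasDerivAt_half id 1 hasDerivAt_id 0).mul_const I).fun_neg.congr_deriv ?_
    simp [logjDeriv]; ring
  · refine (hasDerivAt_logj_oneParam hk hz 0).congr_deriv ?_
    simp [j_oneParam hk, logjDeriv, hk]
    ring

theorem hasDerivAt_mob_oneParam_zero (k : Fin 3) (z : ℂ) :
    HasDerivAt (fun s => mob (oneParam k s).mat z) (mobDeriv k z) 0 := by
  by_cases hk : k = 0
  · subst hk
    have e : ∀ s, mob (oneParam 0 s).mat z = Complex.exp ((s : ℂ) * I) * z := fun s => by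
      rw [mob, j_oneParam_zero, α_oneParam_zero, β_oneParam_zero, add_zero, mul_div_right_comm,
        ← Complex.exp_sub]
      congr 2
      push_cast; ring
    simp only [e]
    have h1 := (((hasDerivAt_id (0 : ℝ)).ofReal_comp.mul_const I).cexp).mul_const z
    exact h1.congr_deriv (by simp [mobDeriv])
  · have hc := hasDerivAt_half _ _ Real.hasDerivAt_cosh 0
    have hs := hasDerivAt_half _ _ Real.hasDerivAt_sinh 0
    have h1 := (hc.mul_const z).fun_add (hs.const_mul (conj (hypDir k)))
    have h2 := hc.fun_add (hs.const_mul (hypDir k * z))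
    have h3 := h1.fun_div h2 (by simp)
    simp only [mob, j_oneParam hk, α_oneParam hk, β_oneParam hk]
    refine h3.congr_deriv ?_
    simp [mobDeriv, hk]
    ring

theorem hasDerivAt_conjIf (s : Bool) {f : ℝ → ℂ} {f' : ℂ} {t : ℝ} (h : HasDerivAt f f' t) :
    HasDerivAt (fun t => conjIf s (f t)) (conjIf s f') t := by
  cases s
  · exact HasFDerivAt.comp_hasDerivAt t Complex.conjCLE.toContinuousLinearMap.hasFDerivAt h
  · simpa [conjIf] using h

/-- The action of `X_k` on holomorphic functions on the disc, in the discrete series. -/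
noncomputable def discDeriv (l : ℝ) (k : Fin 3) (f : ℂ → ℂ) (z : ℂ) : ℂ :=
  2 * l * logjDeriv k z * f z - mobDeriv k z * deriv f z

theorem hasDerivAt_discMult_mul (l : ℝ) (k : Fin 3) {f : ℂ → ℂ}
    (hf : DifferentiableOn ℂ f (Metric.ball 0 1)) {z : ℂ} (hz : ‖z‖ < 1) :
    HasDerivAt (fun t : ℝ => Complex.exp (-(2 * l : ℝ) * (oneParam k (-t)).logj z)
      * f (mob (oneParam k (-t)).mat z)) (discDeriv l k f z) 0 := by
  have h1 := ((hasDerivAt_logj_oneParam_zero k hz.le).const_mul (-(2 * l : ℝ) : ℂ)).cexp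
  have e : mob (oneParam k 0).mat z = z := by rw [oneParam_at_zero, mat_one, mob_one]
  have e' : (oneParam k 0).logj z = 0 := by rw [oneParam_at_zero, logj_one]
  have h2 : HasDerivAt f (deriv f z) (mob (oneParam k 0).mat z) := by
    rw [e]
    exact (hf.differentiableAt (Metric.isOpen_ball.mem_nhds (by simpa using hz))).hasDerivAt
  have h3 := HasDerivAt.comp (0 : ℝ) h2 (hasDerivAt_mob_oneParam_zero k z)
  have h4 := h1.fun_mul h3
  have h5 := HasDerivAt.scomp (0 : ℝ) (by rw [neg_zero]; exact h4) (hasDerivAt_neg (0 : ℝ))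
  refine h5.congr_deriv ?_
  simp only [Function.comp_apply, e, e', discDeriv]
  simp
  ring

theorem generator_discreteSeries_ae (l : ℝ) (s : Bool) (k : Fin 3)
    (v : (generator (discreteSeries l s) k).domain) {f : ℂ → ℂ}
    (hf : DifferentiableOn ℂ f (Metric.ball 0 1))
    (hv : ((v : discreteSpace l s) : Lp ℂ 2 (discMeasure l))
      =ᵐ[discMeasure l] fun z => conjIf s (f z)) :
    ((generator (discreteSeries l s) k v : discreteSpace l s) : Lp ℂ 2 (discMeasure l))
      =ᵐ[discMeasure l] fun z => I * conjIf s (discDeriv l k f z) := by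
  have h1 : HasDerivAt (fun t : ℝ => ((discreteSeries l s (oneParam k t)
      (v : discreteSpace l s) : discreteSpace l s) : Lp ℂ 2 (discMeasure l)))
      ((-I • generator (discreteSeries l s) k v : discreteSpace l s) :
        Lp ℂ 2 (discMeasure l)) 0 :=
    HasFDerivAt.comp_hasDerivAt (0 : ℝ) ((discreteSpace l s).subtypeL.restrictScalars
      ℝ).hasFDerivAt (hasDerivAt_oneParam v)
  have h2 := ae_eq_of_hasDerivAt_Lp h1
    (φ := fun t z => conjIf s (Complex.exp (-(2 * l : ℝ) * (oneParam k (-t)).logj z)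
      * f (mob (oneParam k (-t)).mat z)))
    (φ' := fun z => conjIf s (discDeriv l k f z)) (fun t => ?_)
    (ae_discMeasure l fun z hz => hasDerivAt_conjIf s (hasDerivAt_discMult_mul l k hf hz))
  · rw [Submodule.coe_smul] at h2
    filter_upwards [h2, Lp.coeFn_smul (-I) ((generator (discreteSeries l s) k v :
      discreteSpace l s) : Lp ℂ 2 (discMeasure l))] with z a b
    rw [← a, b, Pi.smul_apply, smul_eq_mul, ← mul_assoc, mul_neg, Complex.I_mul_I, neg_neg,
      one_mul]
  · filter_upwards [(discAction l s).coeFn_rep (oneParam k t) (v : discreteSpace l s),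
      ((discAction l s).quasi (oneParam k t)⁻¹).ae hv] with z a b
    refine a.trans ?_
    rw [b, oneParam_inv, conjIf_mul, conjIf_exp, conjIf_mul, ← Complex.ofReal_neg, conjIf_ofReal]
    simp [discAction, discMult]

/-- The density is positive on the open disc, so the weighted measure has the same null sets there
as Lebesgue measure. -/
theorem eqOn_ball_of_ae_discMeasure {l : ℝ} {f g : ℂ → ℂ}
    (hf : ContinuousOn f (Metric.ball 0 1)) (hg : ContinuousOn g (Metric.ball 0 1))
    (h : f =ᵐ[discMeasure l] g) : EqOn f g (Metric.ball 0 1) := by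
  refine Measure.eqOn_open_of_ae_eq (μ := volume) ?_ Metric.isOpen_ball hf hg
  have hm : Measurable fun z : ℂ => ENNReal.ofReal ((1 - ‖z‖ ^ 2) ^ (2 * l - 2)) := by fun_prop
  have h1 := (ae_withDensity_iff hm).mp h
  filter_upwards [h1, ae_restrict_mem measurableSet_ball] with z hz hb
  refine hz ?_
  have hb' : ‖z‖ < 1 := by simpa using hb
  have : 0 < 1 - ‖z‖ ^ 2 := by nlinarith [norm_nonneg z]
  simpa using Real.rpow_pos_of_pos this _

/-! ### The holomorphic Dirac equation and the vanishing of its solutions. -/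

/-- The Euler operator z∂ keeps the factor z^n and multiplies the leading coefficient by n; unlike ∂
it needs no separate treatment of n = 0. -/
theorem eventually_mul_deriv_pow {f g : ℂ → ℂ} {n : ℕ} (hg : AnalyticAt ℂ g 0)
    (h : ∀ᶠ z in 𝓝 (0 : ℂ), f z = z ^ n * g z) :
    ∀ᶠ z in 𝓝 (0 : ℂ), z * deriv f z = z ^ n * (n * g z + z * deriv g z) := by
  filter_upwards [h.eventually_nhds, hg.eventually_analyticAt] with z h1 h2
  have h3 : HasDerivAt f (n * z ^ (n - 1) * g z + z ^ n * deriv g z) z :=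
    ((hasDerivAt_pow n z).fun_mul h2.differentiableAt.hasDerivAt).congr_of_eventuallyEq h1
  rw [h3.deriv]
  cases n with
  | zero => simp
  | succ n => rw [Nat.add_sub_cancel]; ring

/-- Holomorphic solutions of the Dirac equation in the discrete series vanish. -/
theorem eq_zero_of_dirac_ode {l : ℝ} (hl : 0 < l) {g₀ g₁ : ℂ → ℂ}
    (h₁ : DifferentiableOn ℂ g₁ (Metric.ball 0 1))
    (e₀ : ∀ z ∈ Metric.ball (0 : ℂ) 1,
      l * g₀ z + z * deriv g₀ z = 2 * l * z * g₁ z + z ^ 2 * deriv g₁ z)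
    (e₁ : ∀ z ∈ Metric.ball (0 : ℂ) 1, deriv g₀ z = -(l * g₁ z + z * deriv g₁ z)) :
    (∀ z ∈ Metric.ball (0 : ℂ) 1, g₀ z = 0) ∧ ∀ z ∈ Metric.ball (0 : ℂ) 1, g₁ z = 0 := by
  have hl' : (l : ℂ) ≠ 0 := Complex.ofReal_ne_zero.mpr hl.ne'
  have hball : Metric.ball (0 : ℂ) 1 ∈ 𝓝 0 := Metric.ball_mem_nhds 0 one_pos
  -- Eliminating the derivative of g₀ expresses g₀ through g₁, so only g₁ has to be shown to vanish.
  have e₂ : ∀ z ∈ Metric.ball (0 : ℂ) 1,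
      l * g₀ z = z * (3 * l * g₁ z + 2 * (z * deriv g₁ z)) := fun z hz => by
    linear_combination e₀ z hz - z * e₁ z hz
  have ha : AnalyticOnNhd ℂ g₁ (Metric.ball 0 1) := h₁.analyticOnNhd Metric.isOpen_ball
  have hz₁ : ∀ᶠ z in 𝓝 (0 : ℂ), g₁ z = 0 := by
    by_contra hne
    obtain ⟨n, g, hg, hg0, hge⟩ :=
      ((ha 0 (Metric.mem_ball_self one_pos)).exists_eventuallyEq_pow_smul_nonzero_iff).mpr hne
    simp only [sub_zero, smul_eq_mul] at hge
    have hd := eventually_mul_deriv_pow hg hge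
    set h : ℂ → ℂ := fun z => 3 * l * g z + 2 * (n * g z + z * deriv g z) with hh
    have hha : AnalyticAt ℂ h 0 := by
      have := hg.deriv
      fun_prop
    have h3 : ∀ᶠ z in 𝓝 (0 : ℂ), l * g₀ z = z ^ (n + 1) * h z := by
      filter_upwards [hge, hd, hball] with z a b c
      rw [e₂ z c, b, a, hh]
      ring
    have h4 := eventually_mul_deriv_pow hha h3
    -- Multiplying `e₁` by l z and inserting the factorisations gives z^(n+1) K(z) = 0 near 0.
    set K : ℂ → ℂ := fun z => ((n + 1 : ℕ) : ℂ) * h z + z * deriv h z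
      + l * (l * g z + (n * g z + z * deriv g z)) with hK
    have hKc : ContinuousAt K 0 := by
      have h5 := hg.deriv.continuousAt
      have h6 := hha.deriv.continuousAt
      have h7 := hg.continuousAt
      have h8 := hha.continuousAt
      fun_prop
    have hK0 : ∀ᶠ z in 𝓝[≠] (0 : ℂ), K z = 0 := by
      filter_upwards [nhdsWithin_le_nhds hge, nhdsWithin_le_nhds hd, nhdsWithin_le_nhds h4,
        nhdsWithin_le_nhds hball, self_mem_nhdsWithin] with z a b c d hz
      have hz0 : z ^ (n + 1) ≠ 0 := pow_ne_zero _ hz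
      rw [deriv_const_mul_field, e₁ z d, b, a] at c
      refine (mul_eq_zero.mp ?_).resolve_left hz0
      rw [hK]
      linear_combination -c
    -- The power of z can be cancelled only away from 0; continuity gives the value at 0.
    have hlim : K 0 = 0 := tendsto_nhds_unique (hKc.tendsto.mono_left nhdsWithin_le_nhds)
      (tendsto_const_nhds.congr' (hK0.mono fun z hz => hz.symm))
    -- K(0) is this number times g(0), since h(0) = (3l + 2n) g(0).
    have hpos : (0 : ℝ) < (n + 1) * (3 * l + 2 * n) + l * (l + n) := by positivity
    have : (((n + 1) * (3 * l + 2 * n) + l * (l + n) : ℝ) : ℂ) * g 0 = 0 := by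
      simp only [hK, hh, zero_mul, add_zero] at hlim
      push_cast at hlim ⊢
      linear_combination hlim
    exact (mul_ne_zero (Complex.ofReal_ne_zero.mpr hpos.ne') hg0) this
  have hz₁' : EqOn g₁ 0 (Metric.ball 0 1) :=
    ha.eqOn_zero_of_preconnected_of_eventuallyEq_zero (convex_ball 0 1).isPreconnected
      (Metric.mem_ball_self one_pos) hz₁
  refine ⟨fun z hz => ?_, hz₁'⟩
  have hd : deriv g₁ z = 0 := by
    have : g₁ =ᶠ[𝓝 z] fun _ => 0 := by
      filter_upwards [Metric.isOpen_ball.mem_nhds hz] with w hw using hz₁' hw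
    rw [this.deriv_eq, deriv_const]
  have h := e₂ z hz
  rw [hz₁' hz, hd] at h
  simpa [hl'] using h

theorem eq_zero_of_discDeriv {l : ℝ} (hl : 0 < l) {g₀ g₁ : ℂ → ℂ}
    (h₀ : DifferentiableOn ℂ g₀ (Metric.ball 0 1)) (h₁ : DifferentiableOn ℂ g₁ (Metric.ball 0 1))
    (e₀ : ∀ᵐ z ∂discMeasure l,
      discDeriv l 0 g₀ z + (discDeriv l 1 g₁ z + I * discDeriv l 2 g₁ z) = 0)
    (e₁ : ∀ᵐ z ∂discMeasure l,
      discDeriv l 1 g₀ z - I * discDeriv l 2 g₀ z - discDeriv l 0 g₁ z = 0) :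
    (∀ z ∈ Metric.ball (0 : ℂ) 1, g₀ z = 0) ∧ ∀ z ∈ Metric.ball (0 : ℂ) 1, g₁ z = 0 := by
  have c₀ := h₀.continuousOn
  have c₁ := h₁.continuousOn
  have d₀ := (h₀.deriv Metric.isOpen_ball).continuousOn
  have d₁ := (h₁.deriv Metric.isOpen_ball).continuousOn
  refine eq_zero_of_dirac_ode hl h₁
    (eqOn_ball_of_ae_discMeasure (l := l) (by fun_prop) (by fun_prop) ?_)
    (eqOn_ball_of_ae_discMeasure (l := l) (by fun_prop) (by fun_prop) ?_)
  · filter_upwards [e₀] with z hz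
    simp [discDeriv, logjDeriv, mobDeriv, hypDir] at hz
    linear_combination I * hz + (l * g₀ z + z * deriv g₀ z
      - 2 * l * z * g₁ z - z ^ 2 * deriv g₁ z) * Complex.I_mul_I
  · filter_upwards [e₁] with z hz
    simp [discDeriv, logjDeriv, mobDeriv, hypDir] at hz
    linear_combination -I * hz + (deriv g₀ z + l * g₁ z + z * deriv g₁ z) * Complex.I_mul_I

theorem diracCohomology_discreteSeries {l : ℝ} (hl : 0 < l) (s : Bool) :
    diracCohomology (discreteSeries l s) = ⊥ := by
  rw [eq_bot_iff]
  intro ψ hψ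
  obtain ⟨h, h0, h1⟩ := mem_diracCohomology.mp hψ
  obtain ⟨f₀, hf₀, hv₀⟩ := (ψ 0).2
  obtain ⟨f₁, hf₁, hv₁⟩ := (ψ 1).2
  have g₀ := fun k => generator_discreteSeries_ae l s k ⟨ψ 0, h 0 k⟩ hf₀ hv₀
  have g₁ := fun k => generator_discreteSeries_ae l s k ⟨ψ 1, h 1 k⟩ hf₁ hv₁
  have e₀ : ∀ᵐ z ∂discMeasure l, conjIf s (discDeriv l 0 f₀ z)
      + (conjIf s (discDeriv l 1 f₁ z) + I * conjIf s (discDeriv l 2 f₁ z)) = 0 := by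
    have h2 := congrArg (fun v : discreteSpace l s => (v : Lp ℂ 2 (discMeasure l))) h0
    simp only [Submodule.coe_add, Submodule.coe_smul, Submodule.coe_zero] at h2
    have h3 := Lp.coeFn_zero ℂ 2 (discMeasure l)
    rw [← h2] at h3
    filter_upwards [g₀ 0, g₁ 1, g₁ 2, h3, Lp.coeFn_add (_ : Lp ℂ 2 (discMeasure l)) _,
      Lp.coeFn_add (_ : Lp ℂ 2 (discMeasure l)) _, Lp.coeFn_smul I (_ : Lp ℂ 2 (discMeasure l))]
      with z a b c d e f g
    rw [e, Pi.add_apply, f, Pi.add_apply, g, Pi.smul_apply, a, b, c, Pi.zero_apply,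
      smul_eq_mul] at d
    refine (mul_eq_zero.mp ?_).resolve_left Complex.I_ne_zero
    linear_combination d
  have e₁ : ∀ᵐ z ∂discMeasure l, conjIf s (discDeriv l 1 f₀ z)
      - I * conjIf s (discDeriv l 2 f₀ z) - conjIf s (discDeriv l 0 f₁ z) = 0 := by
    have h2 := congrArg (fun v : discreteSpace l s => (v : Lp ℂ 2 (discMeasure l))) h1
    simp only [Submodule.coe_sub, Submodule.coe_smul, Submodule.coe_zero] at h2
    have h3 := Lp.coeFn_zero ℂ 2 (discMeasure l)
    rw [← h2] at h3
    filter_upwards [g₁ 0, g₀ 1, g₀ 2, h3, Lp.coeFn_sub (_ : Lp ℂ 2 (discMeasure l)) _,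
      Lp.coeFn_sub (_ : Lp ℂ 2 (discMeasure l)) _, Lp.coeFn_smul I (_ : Lp ℂ 2 (discMeasure l))]
      with z a b c d e f g
    rw [e, Pi.sub_apply, f, Pi.sub_apply, g, Pi.smul_apply, a, b, c, Pi.zero_apply,
      smul_eq_mul] at d
    refine (mul_eq_zero.mp ?_).resolve_left Complex.I_ne_zero
    linear_combination d
  have hz : (∀ z ∈ Metric.ball (0 : ℂ) 1, f₀ z = 0) ∧ ∀ z ∈ Metric.ball (0 : ℂ) 1, f₁ z = 0 := by
    cases s
    -- Conjugation changes the sign of i, exchanging H₁ + iH₂ with H₁ - iH₂. Hence (-f₁, f₀) solves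
    -- the holomorphic system, with the two equations interchanged.
    · have hneg : ∀ k z, discDeriv l k (-f₁) z = -discDeriv l k f₁ z := fun k z => by
        rw [discDeriv, discDeriv, deriv.neg, Pi.neg_apply]; ring
      have h2 := eq_zero_of_discDeriv hl hf₁.neg hf₀
        (by
          filter_upwards [e₁] with z hz
          have := congrArg conj hz
          simp [conjIf] at this
          rw [hneg]
          linear_combination this)
        (by
          filter_upwards [e₀] with z hz
          have := congrArg conj hz
          simp [conjIf] at this
          rw [hneg, hneg]
          linear_combination -this)
      exact ⟨h2.2, fun z hz => by simpa using h2.1 z hz⟩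
    · exact eq_zero_of_discDeriv hl hf₀ hf₁ (by simpa [conjIf] using e₀)
        (by simpa [conjIf] using e₁)
  have hc : conjIf s 0 = 0 := by cases s <;> simp [conjIf]
  rw [Submodule.mem_bot, funext_iff, Fin.forall_fin_two]
  constructor <;> refine Subtype.ext (Lp.ext ?_)
  · filter_upwards [hv₀, Lp.coeFn_zero ℂ 2 (discMeasure l),
      ae_discMeasure l fun z hz => hz] with z a b c
    rw [a, hz.1 z (by simpa using c), hc]
    exact b.symm
  · filter_upwards [hv₁, Lp.coeFn_zero ℂ 2 (discMeasure l),
      ae_discMeasure l fun z hz => hz] with z a b c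
    rw [a, hz.2 z (by simpa using c), hc]
    exact b.symm

end DiracSL2

theorem theorem5p2 :
    -- the localised Dirac cohomology vanishes on the discrete series
    (∀ ℓ : ℝ, 1 / 2 < ℓ → ∀ s : Bool,
      DiracSL2.diracCohomology (DiracSL2.discreteSeries ℓ s) = ⊥) ∧
    -- in the principal series it is supported on the parabolic arc
    (∀ q τ : ℝ, 1 / 4 ≤ q → 0 ≤ τ → τ ≤ 1 →
      (DiracSL2.diracCohomology (DiracSL2.principalSeries q τ) ≠ ⊥ ↔
        (q, τ) ∈ DiracSL2.parabolicArc) ∧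
      ∃ f, DiracSL2.IsWeightBasis (DiracSL2.principalSeries q τ) q τ f) ∧
    -- at each point of the arc it is one-dimensional, spanned by the given spinor
    (∀ q τ : ℝ, (q, τ) ∈ DiracSL2.parabolicArc →
      (1 / 4 ≤ q ∧ 0 ≤ τ ∧ τ ≤ 1) ∧
      Module.finrank ℂ (DiracSL2.diracCohomology (DiracSL2.principalSeries q τ)) = 1 ∧
      ∀ f, DiracSL2.IsWeightBasis (DiracSL2.principalSeries q τ) q τ f →
        DiracSL2.diracCohomology (DiracSL2.principalSeries q τ) =
          Submodule.span ℂ {![((√(1 - τ) : ℝ) : ℂ) • f 0, -((√τ : ℝ) : ℂ) • f (-1)]}) := by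
  refine ⟨fun ℓ hℓ s => DiracSL2.diracCohomology_discreteSeries (by linarith) s,
    fun q τ hq h0 h1 => ?_, fun q τ harc => ?_⟩
  · obtain ⟨f, hf⟩ := DiracSL2.exists_isWeightBasis τ hq
    exact ⟨hf.diracCohomology_ne_bot_iff hq h0 h1, f, hf⟩
  · obtain ⟨hq, h0, h1⟩ := DiracSL2.bounds_of_mem_parabolicArc harc
    obtain ⟨f, hf⟩ := DiracSL2.exists_isWeightBasis τ hq
    exact ⟨⟨hq, h0.le, h1.le⟩, hf.finrank_diracCohomology harc,
      fun f hf => hf.diracCohomology_eq_span harc⟩
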